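/- Let $\mathcal H$ be a finite family of finite simple graphs without isolated vertices, let $r=m(\mathcal H)$ be the maximum number of edges of a graph in $\mathcal H$, and let $t\ge 1$ be fixed. In the $\mathcal H$-Packing with $t$-Edge Membership problem the input is a finite simple graph $G$ and an integer $k\ge 0$ (the parameter), and the question is whether $G$ has a set of at least $k$ subgraphs, each isomorphic to some graph in $\mathcal H$, with pairwise different edge sets, such that every edge of $G$ belongs to at most $t$ of these subgraphs. In the NISV (non-identical sets of vertices) variant the chosen subgraphs must in addition have pairwise different vertex sets. Theorem. Each of these two problems has a kernel with $O((r+1)^r k^r)$ vertices: there is a function $C:\mathbb N\to\mathbb N$ such that, for all $\mathcal H$ and $t$ as above, and for each of the two problems, there is a polynomial-time algorithm that transforms every instance $(G,k)$ into an instance $(G',k')$ of the same problem such that $(G',k')$ is a yes-instance if and only if $(G,k)$ is, $k'\le k$, and $|V(G')|\le C(r)\,(r+1)^r k^r$. (Polynomial time is measured in the size of the instance, with $k$ written in unary, for fixed $\mathcal H$ and $t$.) -/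

import Mathlib

/-! ### Polynomial-time computation

The machine model is the textbook WHILE language: programs with finitely many variables, each of
which holds a finite binary tree, built from assignments, sequencing, tests and loops.  Every
operation is charged the full size of the trees that it copies or builds, so a run of cost `T` can
be simulated by a Turing machine in time polynomial in `T` and the input size, and conversely. -/

/-- Finite binary trees, the data on which programs operate. -/
inductive BTree where
  | nil : BTree
  | cons (left right : BTree) : BTree

namespace BTree

/-- The number of nodes, leaves included. -/
def size : BTree → ℕ
  | nil => 1
  | cons a b => a.size + b.size + 1

/-- Left subtree (`nil` for a leaf). -/
def hd : BTree → BTree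
  | nil => nil
  | cons a _ => a

/-- Right subtree (`nil` for a leaf). -/
def tl : BTree → BTree
  | nil => nil
  | cons _ b => b

/-- Natural numbers in unary. -/
def ofNat : ℕ → BTree
  | 0 => nil
  | n + 1 => cons nil (ofNat n)

/-- Booleans: `false` is a leaf, `true` is a tree with two leaves. -/
def ofBool : Bool → BTree
  | false => nil
  | true => cons nil nil

/-- Lists of trees. -/
def ofList : List BTree → BTree
  | [] => nil
  | a :: l => cons a (ofList l)

end BTree

/-- A store assigns a tree to each variable; variables are named by natural numbers. -/
abbrev Store := ℕ → BTree

/-- Expressions. -/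
inductive Expr where
  | var (x : ℕ) : Expr
  | nil : Expr
  | cons (e f : Expr) : Expr
  | hd (e : Expr) : Expr
  | tl (e : Expr) : Expr

namespace Expr

/-- The value of an expression. -/
def eval (s : Store) : Expr → BTree
  | var x => s x
  | nil => BTree.nil
  | cons e f => BTree.cons (e.eval s) (f.eval s)
  | hd e => (e.eval s).hd
  | tl e => (e.eval s).tl

/-- The cost of evaluating an expression: reading a variable copies its whole content. -/
def cost (s : Store) : Expr → ℕ
  | var x => (s x).size
  | nil => 1
  | cons e f => e.cost s + f.cost s + 1
  | hd e => e.cost s + 1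
  | tl e => e.cost s + 1

end Expr

/-- Programs. -/
inductive Cmd where
  /-- `x := e` -/
  | assign (x : ℕ) (e : Expr) : Cmd
  /-- `c; d` -/
  | seq (c d : Cmd) : Cmd
  /-- if `x` is not `nil` then `c`, else `d` -/
  | ite (x : ℕ) (c d : Cmd) : Cmd
  /-- while `x` is not `nil` do `c` -/
  | loop (x : ℕ) (c : Cmd) : Cmd

/-- `Runs c s T s'`: started on the store `s`, the program `c` halts, at cost exactly `T`, with
the store `s'`. -/
inductive Runs : Cmd → Store → ℕ → Store → Prop where
  | assign (x : ℕ) (e : Expr) (s : Store) :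
      Runs (Cmd.assign x e) s (e.cost s) (Function.update s x (e.eval s))
  | seq {c d : Cmd} {s s' s'' : Store} {T T' : ℕ} :
      Runs c s T s' → Runs d s' T' s'' → Runs (Cmd.seq c d) s (T + T' + 1) s''
  | ite_then {x : ℕ} {c d : Cmd} {s s' : Store} {T : ℕ} :
      s x ≠ BTree.nil → Runs c s T s' → Runs (Cmd.ite x c d) s (T + 1) s'
  | ite_else {x : ℕ} {c d : Cmd} {s s' : Store} {T : ℕ} :
      s x = BTree.nil → Runs d s T s' → Runs (Cmd.ite x c d) s (T + 1) s'
  | loop_stop {x : ℕ} {c : Cmd} {s : Store} :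
      s x = BTree.nil → Runs (Cmd.loop x c) s 1 s
  | loop_step {x : ℕ} {c : Cmd} {s s' s'' : Store} {T T' : ℕ} :
      s x ≠ BTree.nil → Runs c s T s' → Runs (Cmd.loop x c) s' T' s'' →
        Runs (Cmd.loop x c) s (T + T' + 1) s''

/-- The initial store: the input in variable `0`, all other variables `nil`. -/
def inputStore (a : BTree) : Store := Function.update (fun _ => BTree.nil) 0 a

/-- `OutputsInTime p a b T`: on input `a` the program `p` halts with output `b` (the content of
variable `0`) at cost at most `T`. -/
def OutputsInTime (p : Cmd) (a b : BTree) (T : ℕ) : Prop :=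
  ∃ (T' : ℕ) (s : Store), T' ≤ T ∧ Runs p (inputStore a) T' s ∧ s 0 = b

/-! ### Parameterized graph problems and kernels -/

open Classical in
/-- The adjacency matrix of a graph, as a list of rows. -/
noncomputable def encodeGraph {n : ℕ} (G : SimpleGraph (Fin n)) : BTree :=
  BTree.ofList (List.ofFn fun i : Fin n =>
    BTree.ofList (List.ofFn fun j : Fin n => BTree.ofBool (decide (G.Adj i j))))

/-- An instance: the parameter in unary, followed by the adjacency matrix. -/
noncomputable def encodeInstance {n : ℕ} (G : SimpleGraph (Fin n)) (k : ℕ) : BTree :=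
  BTree.cons (BTree.ofNat k) (encodeGraph G)

/-- A graph problem parameterized by a natural number: the set of its yes-instances `(G, k)`. -/
abbrev ParamGraphProblem := ∀ n : ℕ, SimpleGraph (Fin n) → ℕ → Prop

/-- `Q` has a kernel with at most `b k` vertices: some program transforms, in polynomial time,
every instance `(G, k)` into an equivalent instance `(G', k')` such that `k' ≤ k` and `G'` has at
most `b k` vertices. -/
def HasKernelWithVertices (Q : ParamGraphProblem) (b : ℕ → ℕ) : Prop :=
  ∃ (p : Cmd) (q : Polynomial ℕ), ∀ (n : ℕ) (G : SimpleGraph (Fin n)) (k : ℕ),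
    ∃ (n' : ℕ) (G' : SimpleGraph (Fin n')) (k' : ℕ),
      OutputsInTime p (encodeInstance G k) (encodeInstance G' k')
        (q.eval (encodeInstance G k).size) ∧
      (Q n G k ↔ Q n' G' k') ∧ k' ≤ k ∧ n' ≤ b k

/-! ### Packing with edge membership -/

/-- A finite family of finite graphs. -/
abbrev GraphFamily := Finset (Σ h : ℕ, SimpleGraph (Fin h))

/-- The maximum number of edges of a member of the family (`0` for the empty family). -/
noncomputable def maxEdges (F : GraphFamily) : ℕ := F.sup fun H => H.2.edgeSet.ncard

/-- No member of the family has an isolated vertex. -/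
def NoIsolatedVertices (F : GraphFamily) : Prop := ∀ H ∈ F, ∀ v, ¬ H.2.IsIsolated v

/-- `S` is isomorphic to some member of the family `F`. -/
def IsFamilySubgraph (F : GraphFamily) {n : ℕ} {G : SimpleGraph (Fin n)} (S : G.Subgraph) : Prop :=
  ∃ H ∈ F, Nonempty (S.coe ≃g H.2)

/-- `K` is a set of subgraphs of `G` with pairwise different edge sets, each isomorphic to a member
of `F`, such that every edge of `G` belongs to at most `t` of them. -/
def IsEdgeMembership (F : GraphFamily) (t : ℕ) {n : ℕ} {G : SimpleGraph (Fin n)}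
    (K : Finset G.Subgraph) : Prop :=
  (∀ S ∈ K, IsFamilySubgraph F S) ∧
  (∀ S ∈ K, ∀ S' ∈ K, S ≠ S' → S.edgeSet ≠ S'.edgeSet) ∧
  ∀ e ∈ G.edgeSet, {S | S ∈ K ∧ e ∈ S.edgeSet}.ncard ≤ t

/-- Packing with `t`-edge membership: are there at least `k` such subgraphs? -/
def EdgeMembershipProblem (F : GraphFamily) (t : ℕ) : ParamGraphProblem := fun _ G k =>
  ∃ K : Finset G.Subgraph, k ≤ K.card ∧ IsEdgeMembership F t K

/-- The variant with non-identical sets of vertices: the chosen subgraphs must moreover have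
pairwise different vertex sets. -/
def EdgeMembershipProblemNISV (F : GraphFamily) (t : ℕ) : ParamGraphProblem := fun _ G k =>
  ∃ K : Finset G.Subgraph, k ≤ K.card ∧ IsEdgeMembership F t K ∧
    ∀ S ∈ K, ∀ S' ∈ K, S ≠ S' → S.verts ≠ S'.verts

/-! Without isolated vertices a copy is determined by its edge set, and its vertices are the end
points of its edges. Both problems therefore ask for `k` members of a system of sets of at most `r`
edges such that every edge lies in at most `t` of them and, for NISV, `endpoints` is injective on
the choice.

The kernel comes from a small subsystem, selected greedily. A copy S is discarded if it is kept
already, or if some Y ⊂ S is properly contained in at least B(|Y|) kept copies, where B(r) = 0 and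
B(j) = (r+g)k(B(j+1)+1), and g bounds the number of copies on a given vertex set. Discarding is
harmless (`exists_exchange`). Suppose that a solution uses S. Its other k-1 members cover at most
r(k-1) edges. For each such edge e outside Y, at most B(|Y|+1)+1 kept copies contain Y ∪ {e}, and at
most g(k-1) kept copies share a vertex set with another member. Together these are fewer than
B(|Y|), so some kept T ⊃ Y is none of them. Replacing S by T adds no load on Y, which S contains,
and the other edges of T get load 1 ≤ t. Iteration yields a solution among the kept copies
(`IsPackingOfSize.exists_of_selection`).

For Y = ∅ this keeps at most B(0) ≤ r((r+g)k)^r nonempty copies (`card_filter_select_le`,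
`threshold_le`), each with at most 2r vertices. The kernel is the subgraph induced on these
vertices, with `k` unchanged; g depends on r only and is absorbed by the constant.

For the running time, `PolyTime` is closed under composition, pairing, branching and folds with
polynomially bounded accumulators. As the family is fixed, its members are built into the program
and there are only polynomially many vertex tuples to enumerate. -/

/-! ### Polynomial-time functions between encoded types -/

/-- Types whose elements are represented by trees. -/
class TreeCode (α : Type) where
  /-- The tree that represents an element. -/
  code : α → BTree

open TreeCode (code)

/-- The size of the tree that represents `a`. -/
def csize {α : Type} [TreeCode α] (a : α) : ℕ := (code a).size

instance : TreeCode ℕ := ⟨BTree.ofNat⟩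
instance : TreeCode Bool := ⟨BTree.ofBool⟩
instance : TreeCode Unit := ⟨fun _ => BTree.nil⟩
instance {α β : Type} [TreeCode α] [TreeCode β] : TreeCode (α × β) :=
  ⟨fun p => BTree.cons (code p.1) (code p.2)⟩
instance {α : Type} [TreeCode α] : TreeCode (List α) := ⟨fun l => BTree.ofList (l.map code)⟩

section Codes

variable {α β : Type} [TreeCode α] [TreeCode β]

theorem BTree.size_pos (a : BTree) : 1 ≤ a.size := by cases a <;> simp [BTree.size]

theorem one_le_csize (a : α) : 1 ≤ csize a := BTree.size_pos _

theorem code_pair (a : α) (b : β) : code (a, b) = BTree.cons (code a) (code b) := rfl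

@[simp] theorem code_list_nil : code ([] : List α) = BTree.nil := rfl

theorem code_list_cons (a : α) (l : List α) : code (a :: l) = BTree.cons (code a) (code l) := rfl

@[simp] theorem csize_pair (a : α) (b : β) : csize (a, b) = csize a + csize b + 1 := rfl

@[simp] theorem csize_nil : csize ([] : List α) = 1 := rfl

@[simp] theorem csize_cons (a : α) (l : List α) : csize (a :: l) = csize a + csize l + 1 := rfl

theorem csize_append (l l' : List α) : csize (l ++ l') + 1 = csize l + csize l' := by
  induction l with
  | nil => simp; omega
  | cons a l ih => simp; omega

theorem csize_le_of_mem {a : α} {l : List α} (h : a ∈ l) : csize a ≤ csize l := by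
  induction l with
  | nil => simp at h
  | cons b l ih =>
    simp only [csize_cons]
    rcases List.mem_cons.1 h with rfl | h
    · omega
    · have := ih h
      omega

theorem length_le_csize (l : List α) : l.length ≤ csize l := by
  induction l with
  | nil => simp
  | cons b l ih => simp; omega

theorem csize_le_of_prefix {l l' : List α} (h : l' <+: l) : csize l' ≤ csize l := by
  obtain ⟨m, rfl⟩ := h
  have := csize_append l' m
  have := one_le_csize m
  omega

theorem csize_nat (n : ℕ) : csize n = 2 * n + 1 := by
  induction n with
  | zero => rfl
  | succ n ih =>
    have : csize (n + 1) = 1 + csize n + 1 := rfl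
    omega

/-- Unary numbers are lists of units, so arithmetic reduces to list processing. -/
theorem code_nat (n : ℕ) : code n = code (List.replicate n ()) := by
  induction n with
  | zero => rfl
  | succ n ih => rw [List.replicate_succ, code_list_cons, ← ih]; rfl

end Codes

theorem eval_mono (q : Polynomial ℕ) {m n : ℕ} (h : m ≤ n) : q.eval m ≤ q.eval n := by
  induction q using Polynomial.induction_on' with
  | add p q hp hq => simp only [Polynomial.eval_add]; omega
  | monomial i a => simp only [Polynomial.eval_monomial]; gcongr

theorem Expr.size_eval_le_cost (s : Store) (e : Expr) : (e.eval s).size ≤ e.cost s := by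
  induction e with
  | var x => exact le_rfl
  | nil => exact le_rfl
  | cons e f ihe ihf => simp only [Expr.eval, Expr.cost, BTree.size]; omega
  | hd e ih =>
    simp only [Expr.eval, Expr.cost]
    have : (e.eval s).hd.size ≤ (e.eval s).size := by
      cases e.eval s <;> simp [BTree.hd, BTree.size]; omega
    omega
  | tl e ih =>
    simp only [Expr.eval, Expr.cost]
    have : (e.eval s).tl.size ≤ (e.eval s).size := by
      cases e.eval s <;> simp [BTree.tl, BTree.size]; omega
    omega

/-- `f` is computable in polynomial time: for every `d` some program replaces the code of `a` in
the variable `d` by the code of `f a` without changing the variables below `d`. -/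
def PolyTime {α β : Type} [TreeCode α] [TreeCode β] (f : α → β) : Prop :=
  ∃ q : Polynomial ℕ, (∀ a, csize (f a) ≤ q.eval (csize a)) ∧
    ∀ d : ℕ, ∃ c : Cmd, ∀ (s : Store) (a : α), s d = code a →
      ∃ (T : ℕ) (s' : Store), Runs c s T s' ∧ T ≤ q.eval (csize a) ∧ s' d = code (f a) ∧
        ∀ i < d, s' i = s i

namespace PolyTime

variable {α β γ σ : Type} [TreeCode α] [TreeCode β] [TreeCode γ] [TreeCode σ]

theorem congr {f g : α → β} (hf : PolyTime f) (h : ∀ a, g a = f a) : PolyTime g := by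
  rwa [show g = f from funext h]

theorem of_expr {f : α → β} (q : Polynomial ℕ)
    (h : ∀ d, ∃ e : Expr, ∀ (s : Store) (a : α), s d = code a →
      e.eval s = code (f a) ∧ e.cost s ≤ q.eval (csize a)) : PolyTime f := by
  refine ⟨q, fun a => ?_, fun d => ?_⟩
  · obtain ⟨e, he⟩ := h 0
    obtain ⟨h1, h2⟩ := he (fun _ => code a) a rfl
    have := Expr.size_eval_le_cost (fun _ => code a) e
    rw [h1] at this
    exact this.trans h2
  · obtain ⟨e, he⟩ := h d
    refine ⟨Cmd.assign d e, fun s a hs => ⟨_, _, Runs.assign d e s, (he s a hs).2, ?_, ?_⟩⟩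
    · simp [(he s a hs).1]
    · intro i hi
      simp [Function.update_of_ne hi.ne]

/-- Programs see only trees, so a function that merely retypes its argument costs one trivial
assignment. -/
theorem of_code {f : α → β} (h : ∀ a, code (f a) = code a) : PolyTime f :=
  of_expr Polynomial.X fun d => ⟨Expr.var d, fun s a hs => by
    simp [Expr.eval, Expr.cost, hs, h, csize]⟩

theorem _root_.BTree.exists_expr (b : BTree) : ∃ e : Expr, ∃ N, ∀ s, e.eval s = b ∧ e.cost s = N := by
  induction b with
  | nil => exact ⟨Expr.nil, 1, fun s => ⟨rfl, rfl⟩⟩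
  | cons a b iha ihb =>
    obtain ⟨e, N, he⟩ := iha
    obtain ⟨e', N', he'⟩ := ihb
    exact ⟨Expr.cons e e', N + N' + 1, fun s => by simp [Expr.eval, Expr.cost, he s, he' s]⟩

theorem const (b : β) : PolyTime (fun _ : α => b) := by
  obtain ⟨e, N, he⟩ := (code b).exists_expr
  exact of_expr (Polynomial.C N) fun d => ⟨e, fun s a _ => by simp [he s]⟩

theorem comp {g : β → γ} {f : α → β} (hg : PolyTime g) (hf : PolyTime f) :
    PolyTime (fun a => g (f a)) := by
  obtain ⟨qf, hf1, hf2⟩ := hf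
  obtain ⟨qg, hg1, hg2⟩ := hg
  have hm : ∀ a, qg.eval (csize (f a)) ≤ qg.eval (qf.eval (csize a)) :=
    fun a => eval_mono qg (hf1 a)
  refine ⟨qf + qg.comp qf + 1, fun a => ?_, fun d => ?_⟩
  · have := hg1 (f a)
    have := hm a
    simp only [Polynomial.eval_add, Polynomial.eval_comp, Polynomial.eval_one]
    omega
  · obtain ⟨cf, hcf⟩ := hf2 d
    obtain ⟨cg, hcg⟩ := hg2 d
    refine ⟨Cmd.seq cf cg, fun s a hs => ?_⟩
    obtain ⟨T, s', h1, h2, h3, h4⟩ := hcf s a hs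
    obtain ⟨T', s'', h1', h2', h3', h4'⟩ := hcg s' (f a) h3
    refine ⟨_, _, Runs.seq h1 h1', ?_, h3', fun i hi => by rw [h4' i hi, h4 i hi]⟩
    have := hm a
    simp only [Polynomial.eval_add, Polynomial.eval_comp, Polynomial.eval_one]
    omega

theorem fst : PolyTime (Prod.fst : α × β → α) :=
  of_expr (Polynomial.X + 1) fun d => ⟨Expr.hd (Expr.var d), by
    rintro s ⟨a, b⟩ hs
    simp [Expr.eval, Expr.cost, hs, csize, code_pair, BTree.hd]⟩

theorem snd : PolyTime (Prod.snd : α × β → β) :=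
  of_expr (Polynomial.X + 1) fun d => ⟨Expr.tl (Expr.var d), by
    rintro s ⟨a, b⟩ hs
    simp [Expr.eval, Expr.cost, hs, csize, code_pair, BTree.tl]⟩

/-- Variables are used like a stack: the input stays in `d` while one program works from `d + 1` and
the other from `d + 2`, and neither disturbs what lies below it. -/
theorem pair {f : α → β} {g : α → γ} (hf : PolyTime f) (hg : PolyTime g) :
    PolyTime (fun a => (f a, g a)) := by
  obtain ⟨qf, hf1, hf2⟩ := hf
  obtain ⟨qg, hg1, hg2⟩ := hg
  refine ⟨2 * qf + 2 * qg + 2 * Polynomial.X + 10, fun a => ?_, fun d => ?_⟩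
  · have := hf1 a
    have := hg1 a
    simp only [csize_pair, Polynomial.eval_add, Polynomial.eval_mul, Polynomial.eval_ofNat,
      Polynomial.eval_X]
    omega
  · obtain ⟨cf, hcf⟩ := hf2 (d + 1)
    obtain ⟨cg, hcg⟩ := hg2 (d + 2)
    refine ⟨Cmd.seq (Cmd.assign (d + 1) (Expr.var d)) (Cmd.seq cf
      (Cmd.seq (Cmd.assign (d + 2) (Expr.var d)) (Cmd.seq cg
        (Cmd.assign d (Expr.cons (Expr.var (d + 1)) (Expr.var (d + 2))))))), fun s a hs => ?_⟩
    obtain ⟨T, s1, h1, h2, h3, h4⟩ := hcf (Function.update s (d + 1) (s d)) a (by simp [hs])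
    have hd1 : s1 d = code a := by rw [h4 d (by omega)]; simp [hs]
    obtain ⟨T', s2, h1', h2', h3', h4'⟩ := hcg (Function.update s1 (d + 2) (s1 d)) a (by simp [hd1])
    have hd2 : s2 (d + 1) = code (f a) := by rw [h4' (d + 1) (by omega)]; simp [h3]
    refine ⟨_, _, Runs.seq (Runs.assign _ _ _) (Runs.seq h1 (Runs.seq (Runs.assign _ _ _)
      (Runs.seq h1' (Runs.assign _ _ _)))), ?_, ?_, fun i hi => ?_⟩
    · have := hf1 a
      have := hg1 a
      simp only [Expr.cost, hs, hd1, hd2, h3', Polynomial.eval_add, Polynomial.eval_mul,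
        Polynomial.eval_ofNat, Polynomial.eval_X]
      simp only [csize] at *
      omega
    · simp [Expr.eval, hd2, h3', code_pair]
    · rw [Function.update_of_ne hi.ne, h4' i (by omega), Function.update_of_ne (by omega),
        h4 i (by omega), Function.update_of_ne (by omega)]

theorem comp₂ {g : β × γ → σ} {f : α → β} {f' : α → γ} (hg : PolyTime g) (hf : PolyTime f)
    (hf' : PolyTime f') : PolyTime (fun a => g (f a, f' a)) :=
  hg.comp (hf.pair hf')

theorem ite {b : α → Bool} {f g : α → β} (hb : PolyTime b) (hf : PolyTime f) (hg : PolyTime g) :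
    PolyTime (fun a => if b a then f a else g a) := by
  obtain ⟨qb, hb1, hb2⟩ := hb
  obtain ⟨qf, hf1, hf2⟩ := hf
  obtain ⟨qg, hg1, hg2⟩ := hg
  refine ⟨qb + qf + qg + Polynomial.X + 10, fun a => ?_, fun d => ?_⟩
  · have := hf1 a
    have := hg1 a
    simp only [Polynomial.eval_add, Polynomial.eval_ofNat, Polynomial.eval_X]
    split <;> omega
  · obtain ⟨cb, hcb⟩ := hb2 (d + 1)
    obtain ⟨cf, hcf⟩ := hf2 d
    obtain ⟨cg, hcg⟩ := hg2 d
    refine ⟨Cmd.seq (Cmd.assign (d + 1) (Expr.var d)) (Cmd.seq cb (Cmd.ite (d + 1) cf cg)),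
      fun s a hs => ?_⟩
    obtain ⟨T, s1, h1, h2, h3, h4⟩ := hcb (Function.update s (d + 1) (s d)) a (by simp [hs])
    have hd1 : s1 d = code a := by rw [h4 d (by omega)]; simp [hs]
    have hlow : ∀ i < d, s1 i = s i := fun i hi => by
      rw [h4 i (by omega), Function.update_of_ne (by omega)]
    cases hba : b a with
    | true =>
      obtain ⟨T', s2, h1', h2', h3', h4'⟩ := hcf s1 a hd1
      refine ⟨_, _, Runs.seq (Runs.assign _ _ _) (Runs.seq h1 (Runs.ite_then ?_ h1')), ?_, ?_,
        fun i hi => by rw [h4' i hi, hlow i hi]⟩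
      · rw [h3, hba]; exact BTree.noConfusion
      · simp only [Expr.cost, hs, Polynomial.eval_add, Polynomial.eval_ofNat, Polynomial.eval_X]
        simp only [csize] at *
        omega
      · simpa [hba] using h3'
    | false =>
      obtain ⟨T', s2, h1', h2', h3', h4'⟩ := hcg s1 a hd1
      refine ⟨_, _, Runs.seq (Runs.assign _ _ _) (Runs.seq h1 (Runs.ite_else ?_ h1')), ?_, ?_,
        fun i hi => by rw [h4' i hi, hlow i hi]⟩
      · rw [h3, hba]; rfl
      · simp only [Expr.cost, hs, Polynomial.eval_add, Polynomial.eval_ofNat, Polynomial.eval_X]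
        simp only [csize] at *
        omega
      · simpa [hba] using h3'

/-- The loop that folds the list in the variable `d + 1` into the variable `d + 2`, where `c` is
the body, run on the variable `d + 3`. -/
def foldLoop (d : ℕ) (c : Cmd) : Cmd :=
  Cmd.loop (d + 1) (Cmd.seq
    (Cmd.assign (d + 3) (Expr.cons (Expr.var d)
      (Expr.cons (Expr.var (d + 2)) (Expr.hd (Expr.var (d + 1))))))
    (Cmd.seq c (Cmd.seq (Cmd.assign (d + 2) (Expr.var (d + 3)))
      (Cmd.assign (d + 1) (Expr.tl (Expr.var (d + 1)))))))

/-- Every pass runs the body on a triple with parts of size at most `csize x`, `N` and `L`, so all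
passes share one cost bound. The induction moves the head of the list into the initial accumulator,
which is why `N` has to bound the results for all prefixes. -/
theorem runs_foldLoop {f : α → σ → β → σ} {q : Polynomial ℕ} {d : ℕ} {c : Cmd}
    (hc : ∀ (s : Store) (p : α × σ × β), s (d + 3) = code p →
      ∃ (T : ℕ) (s' : Store), Runs c s T s' ∧ T ≤ q.eval (csize p) ∧
        s' (d + 3) = code (f p.1 p.2.1 p.2.2) ∧ ∀ i < d + 3, s' i = s i)
    (x : α) (N L : ℕ) (l : List β) (hL : csize l ≤ L) (y : σ)
    (hN : ∀ l', l' <+: l → csize (l'.foldl (f x) y) ≤ N) (s : Store) (hs : s d = code x)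
    (hs1 : s (d + 1) = code l) (hs2 : s (d + 2) = code y) :
    ∃ (T : ℕ) (s' : Store), Runs (foldLoop d c) s T s' ∧
      T ≤ l.length * (csize x + 2 * N + 2 * L + 10 + q.eval (csize x + N + L + 2)) + 1 ∧
      s' (d + 2) = code (l.foldl (f x) y) ∧ ∀ i < d, s' i = s i := by
  induction l generalizing y s with
  | nil => exact ⟨1, s, Runs.loop_stop hs1, by simp, hs2, fun _ _ => rfl⟩
  | cons a l ih =>
    have ha : csize a + csize l + 1 ≤ L := by simpa using hL
    have hy : csize y ≤ N := hN [] (List.nil_prefix)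
    have hy' : csize (f x y a) ≤ N := hN [a] (by simp)
    rw [code_list_cons] at hs1
    obtain ⟨T, s1, h1, h2, h3, h4⟩ := hc
      (Function.update s (d + 3) (BTree.cons (s d) (BTree.cons (s (d + 2)) (s (d + 1)).hd)))
      (x, y, a) (by simp [hs, hs1, hs2, BTree.hd, code_pair])
    have e0 : s1 d = code x := by rw [h4 d (by omega)]; simp [hs]
    have e1 : s1 (d + 1) = BTree.cons (code a) (code l) := by
      rw [h4 (d + 1) (by omega)]; simp [hs1]
    obtain ⟨T', s2, h1', h2', h3', h4'⟩ := ih (by omega) (f x y a)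
      (fun l' hl' => hN (a :: l') (by simpa using hl'))
      (Function.update (Function.update s1 (d + 2) (s1 (d + 3))) (d + 1) (s1 (d + 1)).tl)
      (by simp [e0]) (by simp [e1, BTree.tl]) (by simp [h3])
    refine ⟨_, s2, Runs.loop_step (T' := T') (by rw [hs1]; exact BTree.noConfusion)
      (Runs.seq (Runs.assign _ _ _) (Runs.seq h1 (Runs.seq (Runs.assign _ _ _)
        (Runs.assign _ _ _)))) (by simpa [Expr.eval, foldLoop] using h1'), ?_, h3', ?_⟩
    · have hq : q.eval (csize (x, y, a)) ≤ q.eval (csize x + N + L + 2) :=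
        eval_mono q (by simp only [csize_pair]; omega)
      have k1 : (code (f x y a)).size ≤ N := hy'
      have k2 : (BTree.cons (code a) (code l)).size ≤ L := hL
      have k3 : (code y).size ≤ N := hy
      have k4 : (code x).size = csize x := rfl
      simp only [Expr.cost, List.length_cons, Nat.succ_mul l.length, Function.update_of_ne
        (show d + 1 ≠ d + 2 by omega), hs, hs1, hs2, e1, h3]
      omega
    · intro i hi
      rw [h4' i hi, Function.update_of_ne (by omega), Function.update_of_ne (by omega),
        h4 i (by omega), Function.update_of_ne (by omega)]

/-- All later loops are instances of this one. The bound on intermediate results is essential: a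
polynomial-time step may double the size of the accumulator, and iteration would make it
exponential. -/
theorem foldl {f : α → σ → β → σ} {l : α → List β} {y : α → σ}
    (hf : PolyTime (fun p : α × σ × β => f p.1 p.2.1 p.2.2)) (hl : PolyTime l) (hy : PolyTime y)
    (hN : ∃ N : Polynomial ℕ, ∀ a l', l' <+: l a →
      csize (l'.foldl (f a) (y a)) ≤ N.eval (csize a)) :
    PolyTime (fun a => (l a).foldl (f a) (y a)) := by
  obtain ⟨qf, hf1, hf2⟩ := hf
  obtain ⟨ql, hl1, hl2⟩ := hl
  obtain ⟨qy, hy1, hy2⟩ := hy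
  obtain ⟨N, hN⟩ := hN
  refine ⟨ql + qy + 3 * Polynomial.X + 20 + 2 * N + ql * (Polynomial.X + 2 * N + 2 * ql + 10 +
    qf.comp (Polynomial.X + N + ql + 2)), fun a => ?_, fun d => ?_⟩
  · have := hN a _ List.prefix_rfl
    simp only [Polynomial.eval_add, Polynomial.eval_mul, Polynomial.eval_ofNat,
      Polynomial.eval_X, Polynomial.eval_comp]
    omega
  · obtain ⟨cf, hcf⟩ := hf2 (d + 3)
    obtain ⟨cl, hcl⟩ := hl2 (d + 1)
    obtain ⟨cy, hcy⟩ := hy2 (d + 2)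
    refine ⟨Cmd.seq (Cmd.assign (d + 1) (Expr.var d)) (Cmd.seq cl
      (Cmd.seq (Cmd.assign (d + 2) (Expr.var d)) (Cmd.seq cy
        (Cmd.seq (foldLoop d cf) (Cmd.assign d (Expr.var (d + 2))))))), fun s a hs => ?_⟩
    obtain ⟨T, s1, h1, h2, h3, h4⟩ := hcl (Function.update s (d + 1) (s d)) a (by simp [hs])
    have hd1 : s1 d = code a := by rw [h4 d (by omega)]; simp [hs]
    obtain ⟨T', s2, h1', h2', h3', h4'⟩ := hcy (Function.update s1 (d + 2) (s1 d)) a (by simp [hd1])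
    have hd2 : s2 (d + 1) = code (l a) := by rw [h4' (d + 1) (by omega)]; simp [h3]
    have hd3 : s2 d = code a := by rw [h4' d (by omega)]; simp [hd1]
    obtain ⟨T3, s3, g1, g2, g3, g4⟩ := runs_foldLoop hcf a (N.eval (csize a)) (ql.eval (csize a))
      (l a) (hl1 a) (y a) (hN a) s2 hd3 hd2 h3'
    refine ⟨_, _, Runs.seq (Runs.assign _ _ _) (Runs.seq h1 (Runs.seq (Runs.assign _ _ _)
      (Runs.seq h1' (Runs.seq g1 (Runs.assign _ _ _))))), ?_, ?_, fun i hi => ?_⟩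
    · have hlen : (l a).length ≤ ql.eval (csize a) := (length_le_csize _).trans (hl1 a)
      have hfin : (code ((l a).foldl (f a) (y a))).size ≤ N.eval (csize a) :=
        hN a _ List.prefix_rfl
      have hmul := Nat.mul_le_mul_right (csize a + 2 * N.eval (csize a) +
        2 * ql.eval (csize a) + 10 + qf.eval (csize a + N.eval (csize a) +
          ql.eval (csize a) + 2)) hlen
      have k4 : (code a).size = csize a := rfl
      simp only [Expr.cost, hs, hd1, g3, Polynomial.eval_add, Polynomial.eval_mul,
        Polynomial.eval_ofNat, Polynomial.eval_X, Polynomial.eval_comp]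
      omega
    · simp [Expr.eval, g3]
    · rw [Function.update_of_ne hi.ne, g4 i hi, h4' i (by omega),
        Function.update_of_ne (by omega), h4 i (by omega), Function.update_of_ne (by omega)]

end PolyTime

namespace PolyTime

variable {α β γ : Type} [TreeCode α] [TreeCode β] [TreeCode γ]

theorem exists_bound {f : α → β} (hf : PolyTime f) :
    ∃ q : Polynomial ℕ, ∀ a, csize (f a) ≤ q.eval (csize a) :=
  ⟨hf.choose, hf.choose_spec.1⟩

/-! #### Lists -/

theorem cons {f : α → β} {l : α → List β} (hf : PolyTime f) (hl : PolyTime l) :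
    PolyTime (fun a => f a :: l a) :=
  (of_code (f := fun p : β × List β => p.1 :: p.2) fun _ => rfl).comp₂ hf hl

theorem tail {l : α → List β} (hl : PolyTime l) : PolyTime (fun a => (l a).tail) := by
  refine (of_expr (f := fun l : List β => l.tail) (Polynomial.X + 1) fun d =>
    ⟨Expr.tl (Expr.var d), ?_⟩).comp hl
  rintro s (_ | ⟨b, l⟩) hs <;>
    simp [Expr.eval, Expr.cost, hs, BTree.tl, code_list_cons, csize]

theorem isEmpty {l : α → List β} (hl : PolyTime l) : PolyTime (fun a => (l a).isEmpty) := by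
  refine (foldl (f := fun _ _ _ => false) (const false) hl (const true)
    ⟨3, fun a l' _ => ?_⟩).congr fun a => ?_
  · generalize List.foldl _ _ l' = b
    cases b <;> simp [csize, code, BTree.ofBool, BTree.size]
  · have : ∀ l : List β, l.foldl (fun _ _ => false) false = false := fun l => by
      induction l <;> simp [*]
    cases l a <;> simp [this]

theorem reverse {l : α → List β} (hl : PolyTime l) : PolyTime (fun a => (l a).reverse) := by
  obtain ⟨q, hq⟩ := hl.exists_bound
  refine (foldl (f := fun _ acc b => b :: acc) (y := fun _ => [])
    (cons (snd.comp snd) (fst.comp snd)) hl (const []) ⟨q, fun a l' h => ?_⟩).congr fun a => ?_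
  · have key : ∀ (m acc : List β),
        csize (m.foldl (fun acc b => b :: acc) acc) + 1 = csize m + csize acc := fun m => by
      induction m with
      | nil => intro acc; simp; omega
      | cons b m ih => intro acc; rw [List.foldl_cons, ih]; simp; omega
    have := key l' []
    have := csize_le_of_prefix h
    have := hq a
    simp only [csize_nil] at *
    omega
  · simp

theorem append {l l' : α → List β} (hl : PolyTime l) (hl' : PolyTime l') :
    PolyTime (fun a => l a ++ l' a) := by
  obtain ⟨q, hq⟩ := hl.reverse.exists_bound
  obtain ⟨q', hq'⟩ := hl'.exists_bound
  refine (foldl (f := fun _ acc b => b :: acc)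
    (cons (snd.comp snd) (fst.comp snd)) hl.reverse hl' ⟨q + q', fun a m h => ?_⟩).congr
      fun a => ?_
  · have key : ∀ (m acc : List β),
        csize (m.foldl (fun acc b => b :: acc) acc) + 1 = csize m + csize acc := fun m => by
      induction m with
      | nil => intro acc; simp; omega
      | cons b m ih => intro acc; rw [List.foldl_cons, ih]; simp; omega
    have := key m (l' a)
    have := csize_le_of_prefix h
    have := hq a
    have := hq' a
    simp only [Polynomial.eval_add]
    omega
  · simp

theorem flatMap {l : α → List β} {f : α → β → List γ} (hl : PolyTime l)
    (hf : PolyTime (fun p : α × β => f p.1 p.2)) : PolyTime (fun a => (l a).flatMap (f a)) := by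
  obtain ⟨q, hq⟩ := hl.reverse.exists_bound
  obtain ⟨qf, hqf⟩ := hf.exists_bound
  refine (foldl (f := fun a acc b => f a b ++ acc) (y := fun _ => [])
    (append (hf.comp₂ fst (snd.comp snd)) (fst.comp snd)) hl.reverse (const [])
      -- At most `q` blocks are prepended, each of size at most `qf` at the size of a pair; the
      -- summand 1 is the empty list.
      ⟨1 + q * qf.comp (Polynomial.X + q + 1), fun a m h => ?_⟩).congr fun a => ?_
  · have hm : csize m ≤ q.eval (csize a) := (csize_le_of_prefix h).trans (hq a)
    have key : ∀ (W : ℕ) (m acc : List _), (∀ b ∈ m, csize (f a b) ≤ W) →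
        csize (m.foldl (fun acc b => f a b ++ acc) acc) ≤ m.length * W + csize acc := by
      intro W m
      induction m with
      | nil => intro acc _; simp
      | cons b m ih =>
        intro acc hW
        have h1 := ih (f a b ++ acc) fun b' hb' => hW b' (List.mem_cons_of_mem _ hb')
        have h2 := hW b List.mem_cons_self
        have h3 := csize_append (f a b) acc
        rw [List.foldl_cons, List.length_cons, Nat.succ_mul]
        omega
    have h1 := key (qf.eval (csize a + q.eval (csize a) + 1)) m [] fun b hb => by
      refine (hqf (a, b)).trans (eval_mono qf ?_)
      have := csize_le_of_mem hb
      simp only [csize_pair]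
      omega
    have h2 := Nat.mul_le_mul_right (qf.eval (csize a + q.eval (csize a) + 1))
      ((length_le_csize m).trans hm)
    simp only [csize_nil, Polynomial.eval_add, Polynomial.eval_mul, Polynomial.eval_comp,
      Polynomial.eval_one, Polynomial.eval_X] at *
    omega
  · rw [List.foldl_reverse]
    induction l a with
    | nil => rfl
    | cons b m ih => simp [ih]

theorem singleton {f : α → β} (hf : PolyTime f) : PolyTime (fun a => [f a]) := cons hf (const [])

theorem map {l : α → List β} {f : α → β → γ} (hl : PolyTime l)
    (hf : PolyTime (fun p : α × β => f p.1 p.2)) : PolyTime (fun a => (l a).map (f a)) :=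
  (hl.flatMap (f := fun a b => [f a b]) hf.singleton).congr fun a => by
    rw [List.map_eq_flatMap]

theorem filter {l : α → List β} {p : α → β → Bool} (hl : PolyTime l)
    (hp : PolyTime (fun x : α × β => p x.1 x.2)) : PolyTime (fun a => (l a).filter (p a)) :=
  (hl.flatMap (f := fun a b => if p a b then [b] else []) (ite hp (snd.singleton) (const []))).congr
    fun a => by
      induction l a with
      | nil => rfl
      | cons b m ih => cases h : p a b <;> simp [h, ih]

theorem not {b : α → Bool} (hb : PolyTime b) : PolyTime (fun a => !b a) :=
  (ite hb (const false) (const true)).congr fun a => by cases b a <;> rfl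

theorem and {b c : α → Bool} (hb : PolyTime b) (hc : PolyTime c) : PolyTime (fun a => b a && c a) :=
  (ite hb hc (const false)).congr fun a => by cases b a <;> rfl

theorem or {b c : α → Bool} (hb : PolyTime b) (hc : PolyTime c) : PolyTime (fun a => b a || c a) :=
  (ite hb (const true) hc).congr fun a => by cases b a <;> rfl

theorem any {l : α → List β} {p : α → β → Bool} (hl : PolyTime l)
    (hp : PolyTime (fun x : α × β => p x.1 x.2)) : PolyTime (fun a => (l a).any (p a)) :=
  ((hl.filter hp).isEmpty.not).congr fun a => by
    induction l a with
    | nil => rfl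
    | cons b m ih => cases h : p a b <;> simp_all

theorem all {l : α → List β} {p : α → β → Bool} (hl : PolyTime l)
    (hp : PolyTime (fun x : α × β => p x.1 x.2)) : PolyTime (fun a => (l a).all (p a)) :=
  (hl.any (p := fun a b => !p a b) hp.not).not.congr fun a => by
    rw [List.all_eq_not_any_not]

theorem headD {l : α → List β} (hl : PolyTime l) (b : β) : PolyTime (fun a => (l a).headD b) := by
  obtain ⟨q, hq⟩ := hl.reverse.exists_bound
  refine (foldl (f := fun _ _ b => b) (snd.comp snd) hl.reverse (const b)
    ⟨q + Polynomial.C (csize b), fun a m h => ?_⟩).congr fun a => ?_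
  · have key : ∀ (m : List β) (b : β), csize (m.foldl (fun _ b => b) b) ≤ csize m + csize b :=
      fun m => by
        induction m with
        | nil => intro b; simp
        | cons c m ih => intro b; have := ih c; simp; omega
    have := key m b
    have := csize_le_of_prefix h
    have := hq a
    simp only [Polynomial.eval_add, Polynomial.eval_C]
    omega
  · rw [List.foldl_reverse]
    cases l a <;> rfl

/-! #### Natural numbers -/

theorem length {l : α → List β} (hl : PolyTime l) : PolyTime (fun a => (l a).length) :=
  ((of_code (f := fun l : List Unit => l.length) fun l => by
    rw [code_nat]; congr; exact (List.eq_replicate_iff.2 ⟨rfl, fun _ _ => rfl⟩).symm).comp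
      (hl.map (f := fun _ _ => ()) (const ()))).congr fun a => by simp

theorem replicate {n : α → ℕ} (hn : PolyTime n) : PolyTime (fun a => List.replicate (n a) ()) :=
  (of_code (f := fun n : ℕ => List.replicate n ()) fun n => (code_nat n).symm).comp hn

theorem drop {n : α → ℕ} {l : α → List β} (hn : PolyTime n) (hl : PolyTime l) :
    PolyTime (fun a => (l a).drop (n a)) := by
  obtain ⟨q, hq⟩ := hl.exists_bound
  have key : ∀ (m : List Unit) (l : List β), m.foldl (fun acc _ => acc.tail) l = l.drop m.length :=
    fun m => by
      induction m with
      | nil => intro l; rfl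
      | cons _ m ih => intro l; rw [List.foldl_cons, ih]; simp
  refine (foldl (f := fun _ acc _ => acc.tail) (fst.comp snd).tail hn.replicate hl
    ⟨q, fun a m _ => ?_⟩).congr fun a => by rw [key, List.length_replicate]
  rw [key]
  refine le_trans ?_ (hq a)
  have := csize_append ((l a).take m.length) ((l a).drop m.length)
  have := one_le_csize ((l a).take m.length)
  rw [List.take_append_drop] at *
  omega

theorem getD {n : α → ℕ} {l : α → List β} (hl : PolyTime l) (hn : PolyTime n) (b : β) :
    PolyTime (fun a => (l a).getD (n a) b) :=
  ((hn.drop hl).headD b).congr fun a => by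
    rw [List.headD_eq_head?_getD, List.head?_drop, List.getD_eq_getElem?_getD]

theorem add {m n : α → ℕ} (hm : PolyTime m) (hn : PolyTime n) : PolyTime (fun a => m a + n a) :=
  (hm.replicate.append hn.replicate).length.congr fun a => by simp

theorem mul {m n : α → ℕ} (hm : PolyTime m) (hn : PolyTime n) : PolyTime (fun a => m a * n a) :=
  (hm.replicate.flatMap (f := fun a _ => List.replicate (n a) ())
    (hn.comp fst).replicate).length.congr fun a => by simp

theorem le {m n : α → ℕ} (hm : PolyTime m) (hn : PolyTime n) :
    PolyTime (fun a => decide (m a ≤ n a)) :=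
  (hn.drop hm.replicate).isEmpty.congr fun a => by
    rw [Bool.eq_iff_iff]; simp [Nat.sub_eq_zero_iff_le]

theorem natEq {m n : α → ℕ} (hm : PolyTime m) (hn : PolyTime n) :
    PolyTime (fun a => decide (m a = n a)) :=
  ((hm.le hn).and (hn.le hm)).congr fun a => by
    rw [Bool.eq_iff_iff]; simp; omega

/-- The next number to append is the length of the list built so far. -/
theorem range {n : α → ℕ} (hn : PolyTime n) : PolyTime (fun a => List.range (n a)) := by
  have key : ∀ (m : List Unit), m.foldl (fun acc _ => acc ++ [acc.length]) [] =
      List.range m.length := fun m => by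
    induction m using List.reverseRecOn with
    | nil => rfl
    | append_singleton m _ ih => simp [ih, List.range_succ]
  obtain ⟨q, hq⟩ := hn.replicate.exists_bound
  refine (foldl (f := fun _ acc _ => acc ++ [acc.length]) (y := fun _ => [])
    (append (fst.comp snd) (fst.comp snd).length.singleton) hn.replicate (const [])
      ⟨q * (2 * q + 2) + 1, fun a m h => ?_⟩).congr fun a => by rw [key, List.length_replicate]
  have h1 : m.length ≤ q.eval (csize a) :=
    (length_le_csize m).trans ((csize_le_of_prefix h).trans (hq a))
  have h2 : ∀ k, k ≤ q.eval (csize a) →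
      csize (List.range k) ≤ k * (2 * q.eval (csize a) + 2) + 1 := fun k => by
    induction k with
    | zero => intro _; simp
    | succ k ih =>
      intro hk
      have := ih (by omega)
      have := csize_append (List.range k) [k]
      simp only [csize_cons, csize_nil, csize_nat] at this
      rw [List.range_succ, Nat.succ_mul]
      omega
  rw [key]
  refine (h2 _ h1).trans ?_
  simp only [Polynomial.eval_add, Polynomial.eval_mul, Polynomial.eval_ofNat, Polynomial.eval_one]
  gcongr

end PolyTime

/-! #### Unordered pairs of natural numbers -/

instance : TreeCode (Sym2 ℕ) := ⟨fun e => code (e.inf, e.sup)⟩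

namespace PolyTime

variable {α β ι : Type} [TreeCode α] [TreeCode β]

theorem sym2Inf {e : α → Sym2 ℕ} (he : PolyTime e) : PolyTime (fun a => (e a).inf) :=
  (fst.comp (of_code (f := fun e : Sym2 ℕ => (e.inf, e.sup)) fun _ => rfl)).comp he

theorem sym2Sup {e : α → Sym2 ℕ} (he : PolyTime e) : PolyTime (fun a => (e a).sup) :=
  (snd.comp (of_code (f := fun e : Sym2 ℕ => (e.inf, e.sup)) fun _ => rfl)).comp he

theorem sym2Mk {m n : α → ℕ} (hm : PolyTime m) (hn : PolyTime n) :
    PolyTime (fun a => s(m a, n a)) := by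
  have h : PolyTime (fun p : ℕ × ℕ => if decide (p.1 ≤ p.2) then (p.1, p.2) else (p.2, p.1)) :=
    ite (fst.le snd) (fst.pair snd) (snd.pair fst)
  obtain ⟨q, h1, h2⟩ := h
  -- An unordered pair is coded as its sorted pair, so the program that sorts a pair also computes
  -- this function.
  have e : ∀ p : ℕ × ℕ, code s(p.1, p.2) =
      code (if decide (p.1 ≤ p.2) then (p.1, p.2) else (p.2, p.1)) := by
    rintro ⟨a, b⟩
    change code (a ⊓ b, a ⊔ b) = _
    by_cases hab : a ≤ b
    · simp [hab]
    · simp [hab, (not_le.1 hab).le]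
  have h' : PolyTime (fun p : ℕ × ℕ => s(p.1, p.2)) := by
    refine ⟨q, fun a => ?_, fun d => ?_⟩
    · have := h1 a
      simp only [csize, ← e] at this
      exact this
    · obtain ⟨c, hc⟩ := h2 d
      refine ⟨c, fun s a hs => ?_⟩
      rw [e]
      exact hc s a hs
  exact h'.comp₂ hm hn

theorem sym2Eq {e e' : α → Sym2 ℕ} (he : PolyTime e) (he' : PolyTime e') :
    PolyTime (fun a => decide (e a = e' a)) :=
  ((natEq he.sym2Inf he'.sym2Inf).and (natEq he.sym2Sup he'.sym2Sup)).congr fun a => by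
    rw [Bool.eq_iff_iff]
    simp [Sym2.inf_eq_inf_and_sup_eq_sup]

theorem sym2Mem {v : α → ℕ} {e : α → Sym2 ℕ} (hv : PolyTime v) (he : PolyTime e) :
    PolyTime (fun a => decide (v a ∈ e a)) :=
  ((natEq hv he.sym2Inf).or (natEq hv he.sym2Sup)).congr fun a => by
    rw [Bool.eq_iff_iff]
    induction e a with
    | h x y =>
      rcases le_total x y with h | h <;> simp [h, or_comm]

theorem mem [DecidableEq β] (hβ : PolyTime (fun p : β × β => decide (p.1 = p.2)))
    {b : α → β} {l : α → List β} (hb : PolyTime b) (hl : PolyTime l) :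
    PolyTime (fun a => decide (b a ∈ l a)) :=
  (hl.any (p := fun a c => decide (b a = c)) (hβ.comp₂ (hb.comp fst) snd)).congr fun a => by
    rw [Bool.eq_iff_iff]; simp

theorem subset [DecidableEq β] (hβ : PolyTime (fun p : β × β => decide (p.1 = p.2)))
    {l l' : α → List β} (hl : PolyTime l) (hl' : PolyTime l') :
    PolyTime (fun a => decide (l a ⊆ l' a)) :=
  (hl.all (p := fun a b => decide (b ∈ l' a)) (mem hβ snd (hl'.comp fst))).congr fun a => by
    rw [Bool.eq_iff_iff]; simp [List.subset_def]

/-! #### Fixed lists -/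

/-- A list that is not part of the input is unrolled into the program. Its entries need no code and
need not be computable, as is the case for the members of the graph family. -/
theorem any_const (m : List ι) {p : ι → α → Bool} (hp : ∀ i, PolyTime (p i)) :
    PolyTime (fun a => m.any fun i => p i a) := by
  induction m with
  | nil => exact const false
  | cons i m ih => exact (hp i).or ih

theorem all_const (m : List ι) {p : ι → α → Bool} (hp : ∀ i, PolyTime (p i)) :
    PolyTime (fun a => m.all fun i => p i a) := by
  induction m with
  | nil => exact const true
  | cons i m ih => exact (hp i).and ih

theorem map_const (m : List ι) {f : ι → α → β} (hf : ∀ i, PolyTime (f i)) :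
    PolyTime (fun a => m.map fun i => f i a) := by
  induction m with
  | nil => exact const []
  | cons i m ih => exact (hf i).cons ih

theorem flatMap_const (m : List ι) {f : ι → α → List β} (hf : ∀ i, PolyTime (f i)) :
    PolyTime (fun a => m.flatMap fun i => f i a) := by
  induction m with
  | nil => exact const []
  | cons i m ih => exact (hf i).append ih

end PolyTime

/-! ### The exchange argument for abstract set systems -/

section Exchange

variable {α β : Type*} [DecidableEq α]

/-- `K` is a solution of size `k` within the set system `𝒮`: every point belongs to at most `t`
members of `K` and, if `P` holds, then `ν` is injective on `K`. -/
def IsPackingOfSize (𝒮 : Set (Finset α)) (P : Prop) (ν : Finset α → β) (t k : ℕ)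
    (K : Finset (Finset α)) : Prop :=
  K.card = k ∧ (K : Set (Finset α)) ⊆ 𝒮 ∧ (∀ e, (K.filter (e ∈ ·)).card ≤ t) ∧
    (P → Set.InjOn ν (K : Set (Finset α)))

theorem exists_exchange [DecidableEq β] {r g k t : ℕ} (hg : 1 ≤ g) (ht : 1 ≤ t) {B : ℕ → ℕ}
    {𝒯 : Finset (Finset α)} (P : Prop) {ν : Finset α → β}
    (hνg : ∀ b, (𝒯.filter (ν · = b)).card ≤ g)
    (hB : ∀ j < r, (r + g) * k * (B (j + 1) + 1) ≤ B j)
    (h𝒯 : ∀ Y : Finset α, Y.card ≤ r → (𝒯.filter (Y ⊂ ·)).card ≤ B Y.card)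
    {K : Finset (Finset α)} (hr : ∀ S ∈ K, S.card ≤ r) (hk : K.card = k)
    (hKt : ∀ e, (K.filter (e ∈ ·)).card ≤ t) (hKν : P → Set.InjOn ν (K : Set (Finset α)))
    {S : Finset α} (hS : S ∈ K) {Y : Finset α} (hY : Y ⊂ S)
    (hBY : B Y.card ≤ (𝒯.filter (Y ⊂ ·)).card) :
    ∃ T ∈ 𝒯, T ∉ K.erase S ∧ (∀ e, ((insert T (K.erase S)).filter (e ∈ ·)).card ≤ t) ∧
      (P → Set.InjOn ν (insert T (K.erase S) : Finset (Finset α))) := by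
  set K₀ := K.erase S with hK₀
  set U := K₀.biUnion id with hU
  have hk0 : K₀.card + 1 = k := by
    rw [hK₀, Finset.card_erase_add_one hS, hk]
  have hUc : U.card ≤ K₀.card * r :=
    Finset.card_biUnion_le_card_mul _ _ _ fun T hT => hr T (Finset.mem_of_mem_erase hT)
  have hYr : Y.card < r := (Finset.card_lt_card hY).trans_le (hr S hS)
  -- The candidates that cannot replace `S`: those meeting another member outside `Y`, and those
  -- with the same `ν` as another member. The latter are excluded even if `P` fails, since this also
  -- makes the replacement new.
  set bad := (U \ Y).biUnion (fun e => 𝒯.filter (insert e Y ⊆ ·)) ∪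
    K₀.biUnion (fun A => 𝒯.filter (ν · = ν A)) with hbad
  have hbadc : bad.card ≤ K₀.card * r * (B (Y.card + 1) + 1) + K₀.card * g := by
    refine (Finset.card_union_le _ _).trans (add_le_add ?_ ?_)
    · refine (Finset.card_biUnion_le_card_mul _ _ (B (Y.card + 1) + 1) fun e he => ?_).trans
        (Nat.mul_le_mul_right _ ((Finset.card_le_card Finset.sdiff_subset).trans hUc))
      have hc : (insert e Y).card = Y.card + 1 :=
        Finset.card_insert_of_notMem (Finset.mem_sdiff.1 he).2
      calc (𝒯.filter (insert e Y ⊆ ·)).card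
          -- The bound on `𝒯` counts proper supersets only; the set `insert e Y` itself accounts for
          -- the `+ 1`.
          ≤ (insert (insert e Y) (𝒯.filter (insert e Y ⊂ ·))).card := by
            refine Finset.card_le_card fun T hT => ?_
            simp only [Finset.mem_insert, Finset.mem_filter] at hT ⊢
            rcases eq_or_ssubset_of_subset hT.2 with h | h
            · exact Or.inl h.symm
            · exact Or.inr ⟨hT.1, h⟩
        _ ≤ _ := (Finset.card_insert_le _ _).trans
            (Nat.add_le_add_right (hc ▸ h𝒯 (insert e Y) (by omega)) 1)
    · exact Finset.card_biUnion_le_card_mul _ _ _ fun A _ => hνg _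
  -- `K₀` has `k - 1` members, and `g ≥ 1` makes the inequality strict.
  have hlt : bad.card < (𝒯.filter (Y ⊂ ·)).card := by
    refine hbadc.trans_lt (lt_of_lt_of_le ?_ ((hB _ hYr).trans hBY))
    rw [← hk0]
    nlinarith [Nat.zero_le (K₀.card * g * B (Y.card + 1)), Nat.zero_le (r * B (Y.card + 1)),
      Nat.zero_le (g * B (Y.card + 1))]
  obtain ⟨T, hT, hTb⟩ := Finset.exists_mem_notMem_of_card_lt_card hlt
  obtain ⟨hT𝒯, hYT⟩ := Finset.mem_filter.1 hT
  have hdisj : ∀ e ∈ T, e ∈ U → e ∈ Y := by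
    intro e he heU
    by_contra heY
    refine hTb (Finset.mem_union_left _ (Finset.mem_biUnion.2
      ⟨e, Finset.mem_sdiff.2 ⟨heU, heY⟩, Finset.mem_filter.2 ⟨hT𝒯, ?_⟩⟩))
    exact Finset.insert_subset he hYT.subset
  have hνT : ∀ A ∈ K₀, ν T ≠ ν A := fun A hA h =>
    hTb (Finset.mem_union_right _ (Finset.mem_biUnion.2 ⟨A, hA, Finset.mem_filter.2 ⟨hT𝒯, h⟩⟩))
  have hTK : T ∉ K₀ := fun h => hνT T h rfl
  refine ⟨T, hT𝒯, hTK, fun e => ?_, fun hP => ?_⟩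
  · have hsub : K₀.filter (e ∈ ·) ⊆ K.filter (e ∈ ·) :=
      Finset.filter_subset_filter _ (Finset.erase_subset _ _)
    rw [Finset.filter_insert]
    split_ifs with heT
    · by_cases heY : e ∈ Y
      -- On `Y` the new set takes the place of `S`, which also contained `e`.
      · have : insert S (K₀.filter (e ∈ ·)) ⊆ K.filter (e ∈ ·) :=
          Finset.insert_subset (Finset.mem_filter.2 ⟨hS, hY.subset heY⟩) hsub
        have h2 := Finset.card_le_card this
        rw [Finset.card_insert_of_notMem (by simp [hK₀])] at h2
        exact (Finset.card_insert_le _ _).trans (h2.trans (hKt e))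
      · have : K₀.filter (e ∈ ·) = ∅ := Finset.filter_eq_empty_iff.2 fun A hA heA =>
          heY (hdisj e heT (Finset.mem_biUnion.2 ⟨A, hA, heA⟩))
        rw [this]
        simpa using ht
    · exact (Finset.card_le_card hsub).trans (hKt e)
  · rw [Finset.coe_insert, Set.injOn_insert (by exact_mod_cast hTK)]
    refine ⟨(hKν hP).mono (by exact_mod_cast Finset.erase_subset _ _), ?_⟩
    rintro ⟨A, hA, h⟩
    exact hνT A hA h.symm

/-- Each exchange trades a member outside `𝒯` for one inside it, so the number of members outside
decreases. -/
theorem IsPackingOfSize.exists_of_selection [DecidableEq β] {r g k t : ℕ} (hg : 1 ≤ g)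
    (ht : 1 ≤ t) {B : ℕ → ℕ} {𝒮 : Set (Finset α)} {𝒯 : Finset (Finset α)} {P : Prop}
    {ν : Finset α → β} (hr : ∀ S ∈ 𝒮, S.card ≤ r) (h𝒮 : ∀ T ∈ 𝒯, T ∈ 𝒮)
    (hνg : ∀ b, (𝒯.filter (ν · = b)).card ≤ g)
    (hB : ∀ j < r, (r + g) * k * (B (j + 1) + 1) ≤ B j)
    (h𝒯 : ∀ Y : Finset α, Y.card ≤ r → (𝒯.filter (Y ⊂ ·)).card ≤ B Y.card)
    (hrej : ∀ S ∈ 𝒮, S ∈ 𝒯 ∨ ∃ Y ⊂ S, B Y.card ≤ (𝒯.filter (Y ⊂ ·)).card)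
    {K : Finset (Finset α)} (hK : IsPackingOfSize 𝒮 P ν t k K) :
    ∃ K', IsPackingOfSize (𝒯 : Set (Finset α)) P ν t k K' := by
  induction hn : (K \ 𝒯).card using Nat.strong_induction_on generalizing K with
  | _ n ih =>
    obtain ⟨hk, hK𝒮, hKt, hKν⟩ := hK
    rcases (K \ 𝒯).eq_empty_or_nonempty with h0 | ⟨S, hS⟩
    · exact ⟨K, hk, by exact_mod_cast Finset.sdiff_eq_empty_iff_subset.1 h0, hKt, hKν⟩
    · obtain ⟨hSK, hS𝒯⟩ := Finset.mem_sdiff.1 hS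
      obtain ⟨Y, hY, hBY⟩ := (hrej S (hK𝒮 hSK)).resolve_left hS𝒯
      obtain ⟨T, hT, hTK, h1, h2⟩ := exists_exchange hg ht P hνg hB h𝒯
        (fun A hA => hr A (hK𝒮 hA)) hk hKt hKν hSK hY hBY
      refine ih _ ?_ (K := insert T (K.erase S)) ⟨?_, ?_, h1, h2⟩ rfl
      · rw [← hn, Finset.insert_sdiff_of_mem _ hT, Finset.erase_sdiff_comm]
        exact Finset.card_erase_lt_of_mem hS
      · rw [Finset.card_insert_of_notMem hTK, Finset.card_erase_add_one hSK, hk]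
      · intro A hA
        rcases Finset.mem_insert.1 (Finset.mem_coe.1 hA) with rfl | hA
        · exact h𝒮 _ hT
        · exact hK𝒮 (Finset.mem_of_mem_erase hA)

end Exchange

/-! ### Thresholds and the greedy selection -/

/-- The thresholds of the selection, in terms of the number of missing points. -/
def threshold (D k : ℕ) : ℕ → ℕ
  | 0 => 0
  | i + 1 => D * k * (threshold D k i + 1)

theorem threshold_le (D k i : ℕ) : threshold D k i ≤ i * (D * k) ^ i := by
  induction i with
  | zero => simp [threshold]
  | succ i ih =>
    rcases Nat.eq_zero_or_pos (D * k) with h | h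
    · simp [threshold, h]
    -- For positive `D * k`, the `+ 1` in the recursion is absorbed by one more summand `(D * k) ^
    -- i`.
    · have := Nat.one_le_pow i _ h
      calc D * k * (threshold D k i + 1) ≤ D * k * (i * (D * k) ^ i + (D * k) ^ i) := by gcongr
        _ = (i + 1) * (D * k) ^ (i + 1) := by ring

section Selection

variable {α : Type} [DecidableEq α]

/-- The lists of `j` distinct members of `l`. -/
def tuples (l : List α) : ℕ → List (List α)
  | 0 => [[]]
  | j + 1 => (tuples l j).flatMap fun m => (l.filter fun b => !decide (b ∈ m)).map fun b => b :: m

theorem mem_tuples {l : List α} {j : ℕ} {m : List α} :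
    m ∈ tuples l j ↔ m.length = j ∧ m.Nodup ∧ m ⊆ l := by
  induction j generalizing m with
  | zero =>
    simp only [tuples, List.mem_singleton, List.length_eq_zero_iff]
    exact ⟨fun h => by simp [h], fun h => h.1⟩
  | succ j ih =>
    simp only [tuples, List.mem_flatMap, List.mem_map, List.mem_filter, ih]
    constructor
    · rintro ⟨m, ⟨rfl, h2, h3⟩, b, ⟨hb, hb'⟩, rfl⟩
      simp_all
    · rintro ⟨h1, h2, h3⟩
      cases m with
      | nil => simp at h1
      | cons b m =>
        simp only [List.nodup_cons, List.cons_subset, List.length_cons] at h1 h2 h3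
        exact ⟨m, ⟨by omega, h2.2, h3.2⟩, b, ⟨h3.1, by simpa using h2.1⟩, rfl⟩

/-- The number of members of `kept` that properly contain `Y`. -/
def supCount (kept : List (List α)) (Y : List α) : ℕ :=
  (kept.filter fun T => decide (Y ⊆ T) && !decide (T ⊆ Y)).length

/-- Whether `S` is superfluous in addition to the sets already kept. -/
def rejects (r D k : ℕ) (kept : List (List α)) (S : List α) : Bool :=
  (kept.any fun T => decide (S ⊆ T) && decide (T ⊆ S)) ||
    (List.range r).any fun j => (tuples S j).any fun Y =>
      !decide (S ⊆ Y) && decide (threshold D k (r - j) ≤ supCount kept Y)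

/-- The greedy selection of non-superfluous sets. -/
def select (r D k : ℕ) (cs : List (List α)) : List (List α) :=
  cs.foldl (fun kept S => if rejects r D k kept S then kept else S :: kept) []

/-- The set system given by a list of lists. -/
def setSystem (kept : List (List α)) : Finset (Finset α) := (kept.map List.toFinset).toFinset

theorem mem_setSystem {kept : List (List α)} {A : Finset α} :
    A ∈ setSystem kept ↔ ∃ T ∈ kept, T.toFinset = A := by
  simp [setSystem]

theorem toFinset_subset_toFinset_iff {l m : List α} : l.toFinset ⊆ m.toFinset ↔ l ⊆ m := by
  simp [Finset.subset_iff, List.subset_def]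

/-- The algorithm counts lists whereas the argument counts sets; the counts agree when no set is
listed twice. -/
theorem supCount_eq {kept : List (List α)} (h : (kept.map List.toFinset).Nodup) (Y : List α) :
    supCount kept Y = ((setSystem kept).filter (Y.toFinset ⊂ ·)).card := by
  have h1 : ∀ T : List α, (decide (Y ⊆ T) && !decide (T ⊆ Y)) =
      decide (Y.toFinset ⊂ T.toFinset) := fun T => by
    rw [Bool.eq_iff_iff]
    simp [Finset.ssubset_def, toFinset_subset_toFinset_iff]
  have h2 : (kept.map List.toFinset).toFinset.filter (Y.toFinset ⊂ ·) =
      ((kept.map List.toFinset).filter fun T => decide (Y.toFinset ⊂ T)).toFinset := by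
    ext T; simp
  rw [setSystem, h2, List.toFinset_card_of_nodup (h.filter _), List.filter_map,
    List.length_map, supCount]
  congr 2
  funext T
  exact h1 T

/-- Since `S` has at most `r` points, its proper subsets have fewer than `r`, so the search over
`List.range r` misses none. -/
theorem rejects_iff {r D k : ℕ} {kept : List (List α)} (h : (kept.map List.toFinset).Nodup)
    {S : List α} (hS : S.toFinset.card ≤ r) :
    rejects r D k kept S = true ↔ S.toFinset ∈ setSystem kept ∨
      ∃ Y ⊂ S.toFinset, threshold D k (r - Y.card) ≤
        ((setSystem kept).filter (Y ⊂ ·)).card := by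
  simp only [rejects, Bool.or_eq_true, List.any_eq_true, Bool.and_eq_true, decide_eq_true_eq,
    Bool.not_eq_true', decide_eq_false_iff_not, List.mem_range, mem_tuples, mem_setSystem]
  refine or_congr ?_ ?_
  · refine exists_congr fun T => and_congr_right fun _ => ?_
    rw [← toFinset_subset_toFinset_iff, ← toFinset_subset_toFinset_iff]
    exact ⟨fun h => h.2.antisymm h.1, fun h => by simp [h]⟩
  · constructor
    · rintro ⟨j, hj, Y, ⟨rfl, h2, h3⟩, h4, h5⟩
      refine ⟨Y.toFinset, ?_, ?_⟩
      · rw [Finset.ssubset_def, toFinset_subset_toFinset_iff, toFinset_subset_toFinset_iff]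
        exact ⟨h3, h4⟩
      · rwa [List.toFinset_card_of_nodup h2, ← supCount_eq h]
    · rintro ⟨Y, h1, h2⟩
      have e : Y.toList.toFinset = Y := Finset.toList_toFinset Y
      refine ⟨Y.card, (Finset.card_lt_card h1).trans_le hS, Y.toList,
        ⟨Finset.length_toList Y, Finset.nodup_toList Y, ?_⟩, ?_, ?_⟩
      · rw [← toFinset_subset_toFinset_iff, e]; exact h1.subset
      · rw [← toFinset_subset_toFinset_iff, e]; exact h1.not_subset
      · rwa [supCount_eq h, e]

theorem setSystem_cons (S : List α) (kept : List (List α)) :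
    setSystem (S :: kept) = insert S.toFinset (setSystem kept) := by
  simp [setSystem]

theorem select_append_singleton (r D k : ℕ) (cs : List (List α)) (S : List α) :
    select r D k (cs ++ [S]) = if rejects r D k (select r D k cs) S then select r D k cs
      else S :: select r D k cs := by
  rw [select, List.foldl_append]
  rfl

theorem select_nodup {r D k : ℕ} {cs : List (List α)} (hr : ∀ S ∈ cs, S.toFinset.card ≤ r) :
    ((select r D k cs).map List.toFinset).Nodup := by
  induction cs using List.reverseRecOn with
  | nil => simp [select]
  | append_singleton cs S ih =>
    have ih := ih fun S hS => hr S (by simp [hS])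
    rw [select_append_singleton]
    split_ifs with h
    · exact ih
    · rw [rejects_iff ih (hr S (by simp))] at h
      rw [List.map_cons, List.nodup_cons]
      exact ⟨fun h' => h (Or.inl (by simpa [setSystem] using h')), ih⟩

theorem select_subset (r D k : ℕ) (cs : List (List α)) : select r D k cs ⊆ cs := by
  induction cs using List.reverseRecOn with
  | nil => simp [select]
  | append_singleton cs S ih =>
    rw [select_append_singleton]
    split_ifs with h
    · exact List.Subset.trans ih (List.subset_append_left _ _)
    · exact List.cons_subset.2 ⟨by simp, List.Subset.trans ih (List.subset_append_left _ _)⟩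

/-- A set containing `Y` properly is added only while the count for `Y` is strictly below its
threshold, so the count never exceeds it. -/
theorem card_filter_select_le {r D k : ℕ} {cs : List (List α)}
    (hr : ∀ S ∈ cs, S.toFinset.card ≤ r) (Y : Finset α) :
    ((setSystem (select r D k cs)).filter (Y ⊂ ·)).card ≤ threshold D k (r - Y.card) := by
  induction cs using List.reverseRecOn with
  | nil => simp [select, setSystem]
  | append_singleton cs S ih =>
    have hr' : ∀ S ∈ cs, S.toFinset.card ≤ r := fun S hS => hr S (by simp [hS])
    have ih := ih hr'
    rw [select_append_singleton]
    split_ifs with h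
    · exact ih
    · rw [rejects_iff (select_nodup hr') (hr S (by simp))] at h
      push Not at h
      rw [setSystem_cons, Finset.filter_insert]
      split_ifs with hY
      · exact (Finset.card_insert_le _ _).trans (h.2 Y hY)
      · exact ih

/-- The kept system only grows, so a reason for rejection stays valid until the end. -/
theorem mem_or_exists_of_mem {r D k : ℕ} {cs : List (List α)}
    (hr : ∀ S ∈ cs, S.toFinset.card ≤ r) {S : List α} (hS : S ∈ cs) :
    S.toFinset ∈ setSystem (select r D k cs) ∨ ∃ Y ⊂ S.toFinset, threshold D k (r - Y.card) ≤
      ((setSystem (select r D k cs)).filter (Y ⊂ ·)).card := by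
  induction cs using List.reverseRecOn with
  | nil => simp at hS
  | append_singleton cs S' ih =>
    have hr' : ∀ S ∈ cs, S.toFinset.card ≤ r := fun S hS => hr S (by simp [hS])
    have hmono : setSystem (select r D k cs) ⊆ setSystem (select r D k (cs ++ [S'])) := by
      rw [select_append_singleton]
      split_ifs
      · exact subset_rfl
      · rw [setSystem_cons]; exact Finset.subset_insert _ _
    have key : (S.toFinset ∈ setSystem (select r D k cs) ∨ ∃ Y ⊂ S.toFinset,
        threshold D k (r - Y.card) ≤ ((setSystem (select r D k cs)).filter (Y ⊂ ·)).card) →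
        (S.toFinset ∈ setSystem (select r D k (cs ++ [S'])) ∨ ∃ Y ⊂ S.toFinset,
        threshold D k (r - Y.card) ≤
          ((setSystem (select r D k (cs ++ [S']))).filter (Y ⊂ ·)).card) :=
      Or.imp (fun h => hmono h) fun ⟨Y, h1, h2⟩ =>
        ⟨Y, h1, h2.trans (Finset.card_le_card (Finset.filter_subset_filter _ hmono))⟩
    rcases List.mem_append.1 hS with h | h
    · exact key (ih hr' h)
    · obtain rfl := List.mem_singleton.1 h
      by_cases h : rejects r D k (select r D k cs) S = true
      · exact key ((rejects_iff (select_nodup hr') (hr S (by simp))).1 h)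
      · left
        rw [select_append_singleton, if_neg h, setSystem_cons]
        exact Finset.mem_insert_self _ _

end Selection

/-! ### The selection in polynomial time -/

namespace PolyTime

variable {α β : Type} [TreeCode α] [TreeCode β] [DecidableEq β]

theorem threshold {k : α → ℕ} (hk : PolyTime k) (D i : ℕ) :
    PolyTime (fun a => _root_.threshold D (k a) i) := by
  induction i with
  | zero => exact const 0
  | succ i ih => exact ((const D).mul hk).mul (ih.add (const 1))

/-- The induction yields a polynomial for each fixed `j`; its degree may grow with `j`. -/
theorem tuples (hβ : PolyTime (fun p : β × β => decide (p.1 = p.2))) {l : α → List β}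
    (hl : PolyTime l) (j : ℕ) : PolyTime (fun a => _root_.tuples (l a) j) := by
  induction j with
  | zero => exact const [[]]
  | succ j ih =>
    exact ih.flatMap (((hl.comp fst).filter
      (p := fun (q : α × List β) b => !decide (b ∈ q.2)) (mem hβ snd (snd.comp fst)).not).map
        (f := fun (q : α × List β) b => b :: q.2) (snd.cons (snd.comp fst)))

theorem supCount (hβ : PolyTime (fun p : β × β => decide (p.1 = p.2)))
    {kept : α → List (List β)} {Y : α → List β} (hk : PolyTime kept) (hY : PolyTime Y) :
    PolyTime (fun a => _root_.supCount (kept a) (Y a)) :=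
  (hk.filter (p := fun a T => decide (Y a ⊆ T) && !decide (T ⊆ Y a))
    ((subset hβ (hY.comp fst) snd).and (subset hβ snd (hY.comp fst)).not)).length

theorem rejects (hβ : PolyTime (fun p : β × β => decide (p.1 = p.2))) (r D : ℕ) {k : α → ℕ}
    {kept : α → List (List β)} {S : α → List β} (hk : PolyTime k) (hkept : PolyTime kept)
    (hS : PolyTime S) : PolyTime (fun a => _root_.rejects r D (k a) (kept a) (S a)) :=
  (hkept.any (p := fun a T => decide (S a ⊆ T) && decide (T ⊆ S a))
    ((subset hβ (hS.comp fst) snd).and (subset hβ snd (hS.comp fst)))).or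
      (any_const (List.range r) fun j => (tuples hβ hS j).any
        (p := fun a Y => !decide (S a ⊆ Y) &&
          decide (_root_.threshold D (k a) (r - j) ≤ _root_.supCount (kept a) Y))
        ((subset hβ (hS.comp fst) snd).not.and
          (((hk.comp fst).threshold D _).le (supCount hβ (hkept.comp fst) snd))))

theorem select (hβ : PolyTime (fun p : β × β => decide (p.1 = p.2))) (r D : ℕ) {k : α → ℕ}
    {cs : α → List (List β)} (hk : PolyTime k) (hcs : PolyTime cs) :
    PolyTime (fun a => _root_.select r D (k a) (cs a)) := by
  obtain ⟨q, hq⟩ := hcs.exists_bound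
  refine foldl (f := fun a kept S => if _root_.rejects r D (k a) kept S then kept else S :: kept)
    (y := fun _ => []) (ite (rejects hβ r D (hk.comp fst) (fst.comp snd) (snd.comp snd))
      (fst.comp snd) (cons (snd.comp snd) (fst.comp snd))) hcs (const [])
      ⟨q, fun a m h => ?_⟩
  -- Every set added to the accumulator is paid for by the list entry just consumed.
  have key : ∀ (m acc : List (List β)), csize (m.foldl (fun kept S =>
      if _root_.rejects r D (k a) kept S then kept else S :: kept) acc) + 1 ≤
        csize m + csize acc := fun m => by
    induction m with
    | nil => intro acc; simp [add_comm]
    | cons b m ih =>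
      intro acc
      rw [List.foldl_cons]
      refine (ih _).trans ?_
      split_ifs <;> simp only [csize_cons] <;> omega
  have := key m []
  have := csize_le_of_prefix h
  have := hq a
  simp only [csize_nil] at *
  omega

end PolyTime

/-! ### Edge sets of copies and their end points -/

section Copies

variable {V W : Type*} [DecidableEq V] [DecidableEq W]

/-- `A` is the edge set of a copy in `G` of some member of `F`. -/
def IsCopyEdgeSet (F : GraphFamily) (G : SimpleGraph V) (A : Finset (Sym2 V)) : Prop :=
  ∃ H ∈ F, ∃ φ : Fin H.1 → V, Function.Injective φ ∧
    (∀ i j, H.2.Adj i j → G.Adj (φ i) (φ j)) ∧ (A : Set (Sym2 V)) = Sym2.map φ '' H.2.edgeSet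

/-- The end points of the members of a set of edges. -/
def endpoints (A : Finset (Sym2 V)) : Finset V := A.biUnion Sym2.toFinset

theorem mem_endpoints {A : Finset (Sym2 V)} {v : V} : v ∈ endpoints A ↔ ∃ e ∈ A, v ∈ e := by
  simp [endpoints]

theorem card_endpoints_le (A : Finset (Sym2 V)) : (endpoints A).card ≤ 2 * A.card := by
  rw [mul_comm]
  refine Finset.card_biUnion_le_card_mul _ _ _ fun e _ => ?_
  induction e with
  | h x y => rw [Sym2.toFinset_mk_eq]; exact Finset.card_le_two

/-- Such a set consists of unordered pairs, loops allowed, from at most `2 * r` points. This is the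
source of the constant g. -/
theorem card_filter_endpoints_le {r : ℕ} {𝒯 : Finset (Finset (Sym2 V))}
    (hr : ∀ A ∈ 𝒯, A.card ≤ r) (b : Finset V) :
    (𝒯.filter (endpoints · = b)).card ≤ 2 ^ (2 * r + 1).choose 2 := by
  rcases (𝒯.filter (endpoints · = b)).eq_empty_or_nonempty with h | ⟨A, hA⟩
  · simp [h]
  · have hb : b.card ≤ 2 * r := by
      obtain ⟨h1, rfl⟩ := Finset.mem_filter.1 hA
      have := card_endpoints_le A
      have := hr A h1
      omega
    calc (𝒯.filter (endpoints · = b)).card ≤ b.sym2.powerset.card := by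
          refine Finset.card_le_card fun A hA => ?_
          obtain ⟨-, rfl⟩ := Finset.mem_filter.1 hA
          exact Finset.mem_powerset.2 fun e he => Finset.mem_sym2_iff.2 fun v hv =>
            mem_endpoints.2 ⟨e, he, hv⟩
      _ = 2 ^ (b.card + 1).choose 2 := by rw [Finset.card_powerset, Finset.card_sym2]
      _ ≤ _ := Nat.pow_le_pow_right (by norm_num) (Nat.choose_le_choose 2 (by omega))

theorem endpoints_image (f : V → W) (A : Finset (Sym2 V)) :
    endpoints (A.image (Sym2.map f)) = (endpoints A).image f := by
  ext w
  simp only [mem_endpoints, Finset.mem_image]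
  constructor
  · rintro ⟨_, ⟨e, he, rfl⟩, hw⟩
    obtain ⟨v, hv, rfl⟩ := Sym2.mem_map.1 hw
    exact ⟨v, ⟨e, he, hv⟩, rfl⟩
  · rintro ⟨v, ⟨e, he, hv⟩, rfl⟩
    exact ⟨_, ⟨e, he, rfl⟩, Sym2.mem_map.2 ⟨v, hv, rfl⟩⟩

/-- Renaming vertices injectively preserves packings. It serves both to pass from `Fin n` to the
natural numbers used by the algorithm and to embed the kernel in `G`. -/
theorem exists_isPackingOfSize_image_iff {f : V → W} (hf : Function.Injective f)
    {𝒮 : Set (Finset (Sym2 V))} {P : Prop} {t k : ℕ} :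
    (∃ K, IsPackingOfSize (Finset.image (Sym2.map f) '' 𝒮) P endpoints t k K) ↔
      ∃ K, IsPackingOfSize 𝒮 P endpoints t k K := by
  have hinj : Function.Injective (Finset.image (Sym2.map f)) :=
    Finset.image_injective (Sym2.map.injective hf)
  have hfilter : ∀ (K : Finset (Finset (Sym2 V))) (e : Sym2 V),
      ((K.image (Finset.image (Sym2.map f))).filter (Sym2.map f e ∈ ·)).card =
        (K.filter (e ∈ ·)).card := fun K e => by
    rw [Finset.filter_image, Finset.card_image_of_injective _ hinj]
    congr 1
    ext A
    simp [(Sym2.map.injective hf).eq_iff]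
  have hν : ∀ A, endpoints (Finset.image (Sym2.map f) A) = (endpoints A).image f :=
    endpoints_image f
  constructor
  · rintro ⟨K, h1, h2, h3, h4⟩
    obtain ⟨K, hK, rfl⟩ := Finset.subset_set_image_iff.1 h2
    refine ⟨K, by rwa [Finset.card_image_of_injective _ hinj] at h1, hK,
      fun e => hfilter K e ▸ h3 _, fun hP A hA A' hA' h => hinj ?_⟩
    refine h4 hP (Finset.mem_coe.2 (Finset.mem_image_of_mem _ hA))
      (Finset.mem_coe.2 (Finset.mem_image_of_mem _ hA')) ?_
    rw [hν, hν, h]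
  · rintro ⟨K, h1, h2, h3, h4⟩
    refine ⟨K.image (Finset.image (Sym2.map f)), by rwa [Finset.card_image_of_injective _ hinj],
      by rw [Finset.coe_image]; exact Set.image_mono h2, fun e => ?_, fun hP => ?_⟩
    · by_cases he : ∃ e', Sym2.map f e' = e
      · obtain ⟨e, rfl⟩ := he
        rw [hfilter]
        exact h3 e
      · rw [Finset.card_eq_zero.2]
        · exact Nat.zero_le _
        · refine Finset.filter_eq_empty_iff.2 fun B hB heB => he ?_
          obtain ⟨A, -, rfl⟩ := Finset.mem_image.1 hB
          obtain ⟨e', -, h⟩ := Finset.mem_image.1 heB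
          exact ⟨e', h⟩
    · rw [Finset.coe_image]
      rintro _ ⟨A, hA, rfl⟩ _ ⟨A', hA', rfl⟩ h
      rw [hν, hν] at h
      rw [h4 hP hA hA' (Finset.image_injective hf h)]

end Copies

/-! ### Reduction of both problems to set systems -/

section Problems

/-- The common form of the two packing problems: the vertex sets have to be pairwise different
if `P` holds. -/
def PackingProblem (F : GraphFamily) (t : ℕ) (P : Prop) : ParamGraphProblem := fun _ G k =>
  ∃ K : Finset G.Subgraph, k ≤ K.card ∧ IsEdgeMembership F t K ∧
    (P → ∀ S ∈ K, ∀ S' ∈ K, S ≠ S' → S.verts ≠ S'.verts)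

variable {F : GraphFamily} {n : ℕ} {G : SimpleGraph (Fin n)}

/-- The edge set of a subgraph of a finite graph. -/
noncomputable def edges (S : G.Subgraph) : Finset (Sym2 (Fin n)) :=
  (Set.toFinite S.edgeSet).toFinset

@[simp] theorem mem_edges {S : G.Subgraph} {e : Sym2 (Fin n)} : e ∈ edges S ↔ e ∈ S.edgeSet := by
  simp [edges]

theorem IsFamilySubgraph.mem_verts_iff (hF : NoIsolatedVertices F) {S : G.Subgraph}
    (hS : IsFamilySubgraph F S) {v : Fin n} : v ∈ S.verts ↔ v ∈ endpoints (edges S) := by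
  rw [mem_endpoints]
  constructor
  · intro hv
    obtain ⟨H, hH, ⟨ψ⟩⟩ := hS
    have := hF H hH (ψ ⟨v, hv⟩)
    simp only [SimpleGraph.IsIsolated, not_forall, not_not] at this
    obtain ⟨w, hw⟩ := this
    -- A neighbour in the family member pulls back to an edge of `S` at `v`.
    obtain ⟨u, rfl⟩ := ψ.surjective w
    rw [ψ.map_adj_iff] at hw
    exact ⟨s(v, u), by simpa using hw, by simp⟩
  · rintro ⟨e, he, hv⟩
    exact SimpleGraph.Subgraph.mem_verts_of_mem_edge (mem_edges.1 he) hv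

theorem injOn_edges (hF : NoIsolatedVertices F) :
    Set.InjOn (edges (G := G)) {S | IsFamilySubgraph F S} := by
  intro S hS S' hS' h
  refine SimpleGraph.Subgraph.ext ?_ ?_
  · ext v
    rw [IsFamilySubgraph.mem_verts_iff hF hS, IsFamilySubgraph.mem_verts_iff hF hS', h]
  · ext u v
    have : s(u, v) ∈ edges S ↔ s(u, v) ∈ edges S' := by rw [h]
    simpa using this

theorem image_edges : edges (G := G) '' {S | IsFamilySubgraph F S} = {A | IsCopyEdgeSet F G A} := by
  ext A
  constructor
  · rintro ⟨S, ⟨H, hH, ⟨ψ⟩⟩, rfl⟩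
    have hadj : ∀ i j, H.2.Adj i j → S.Adj (ψ.symm i) (ψ.symm j) := fun i j h =>
      ψ.symm.map_adj_iff.2 h
    refine ⟨H, hH, fun i => (ψ.symm i : Fin n), fun i j h => ψ.symm.injective (Subtype.ext h),
      fun i j h => (hadj i j h).adj_sub, ?_⟩
    ext e
    rw [Finset.mem_coe, mem_edges]
    constructor
    · induction e with
      | h u v =>
        intro h
        have h : S.Adj u v := h
        refine ⟨s(ψ ⟨u, h.fst_mem⟩, ψ ⟨v, h.snd_mem⟩), ?_, by simp⟩
        exact ψ.map_adj_iff.2 h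
    · rintro ⟨e, he, rfl⟩
      induction e with
      | h i j => exact hadj i j he
  · rintro ⟨H, hH, φ, hφ, hadj, hA⟩
    let c : SimpleGraph.Copy H.2 G := ⟨⟨φ, fun {i j} h => hadj i j h⟩, hφ⟩
    refine ⟨c.toSubgraph, ⟨H, hH, ⟨c.isoToSubgraph.symm⟩⟩, ?_⟩
    rw [← Finset.coe_inj, hA]
    ext e
    rw [Finset.mem_coe, mem_edges, SimpleGraph.Copy.toSubgraph, SimpleGraph.Subgraph.edgeSet_map]
    simp only [SimpleGraph.Subgraph.edgeSet_top]
    rfl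

theorem ncard_filter_edges (K : Finset G.Subgraph)
    (hK : ∀ S ∈ K, ∀ S' ∈ K, edges S = edges S' → S = S')
    (e : Sym2 (Fin n)) : {S | S ∈ K ∧ e ∈ S.edgeSet}.ncard =
      ((K.image edges).filter (e ∈ ·)).card := by
  classical
  rw [Finset.filter_image, Finset.card_image_of_injOn, ← Set.ncard_coe_finset]
  · congr 1
    ext S
    simp
  · intro S hS S' hS' h
    exact hK S (Finset.mem_of_mem_filter S hS) S' (Finset.mem_of_mem_filter S' hS') h

/-- As `edges` is injective on copies, distinct copies automatically have distinct edge sets, and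
`endpoints` recovers the vertex sets. A solution may be trimmed to exactly `k` members. -/
theorem packingProblem_iff (hF : NoIsolatedVertices F) {t k : ℕ} {P : Prop} :
    PackingProblem F t P n G k ↔
      ∃ K, IsPackingOfSize {A | IsCopyEdgeSet F G A} P endpoints t k K := by
  classical
  have hverts : ∀ S : G.Subgraph, IsFamilySubgraph F S →
      ∀ S' : G.Subgraph, IsFamilySubgraph F S' →
      (endpoints (edges S) = endpoints (edges S') ↔ S.verts = S'.verts) := by
    intro S hS S' hS'
    simp only [Finset.ext_iff, Set.ext_iff, hS.mem_verts_iff hF, hS'.mem_verts_iff hF]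
  rw [← image_edges]
  constructor
  · rintro ⟨K', hk, ⟨h1, -, h3⟩, h4⟩
    obtain ⟨K, hKK', hK⟩ := Finset.exists_subset_card_eq hk
    have hinj : Set.InjOn (edges (G := G)) K := (injOn_edges hF).mono fun S hS => h1 S (hKK' hS)
    refine ⟨K.image edges, by rw [Finset.card_image_of_injOn hinj, hK], ?_, fun e => ?_, ?_⟩
    · rw [Finset.coe_image]
      exact Set.image_mono fun S hS => h1 S (hKK' hS)
    · rw [← ncard_filter_edges K fun S hS S' hS' h => hinj hS hS' h]
      -- The problem bounds the load on edges of `G` only; other pairs lie in no subgraph.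
      by_cases he : e ∈ G.edgeSet
      · refine (Set.ncard_le_ncard ?_ ?_).trans (h3 e he)
        · exact fun S hS => ⟨hKK' hS.1, hS.2⟩
        · exact K'.finite_toSet.subset fun S hS => hS.1
      · rw [show {S | S ∈ K ∧ e ∈ S.edgeSet} = ∅ from
          Set.eq_empty_of_forall_notMem fun S hS => he (S.edgeSet_subset hS.2)]
        simp
    · intro hP
      rw [Finset.coe_image]
      rintro _ ⟨S, hS, rfl⟩ _ ⟨S', hS', rfl⟩ h
      rw [hverts S (h1 S (hKK' hS)) S' (h1 S' (hKK' hS'))] at h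
      by_contra hne
      exact h4 hP S (hKK' hS) S' (hKK' hS') (fun h => hne (by rw [h])) h
  · rintro ⟨_, hk, h2, h3, h4⟩
    obtain ⟨K, hK, rfl⟩ := Finset.subset_set_image_iff.1 h2
    have hinj : Set.InjOn (edges (G := G)) K := (injOn_edges hF).mono hK
    refine ⟨K, by rw [← hk, Finset.card_image_of_injOn hinj],
      ⟨fun S hS => hK hS, fun S hS S' hS' hne h => hne (hinj hS hS' ?_), fun e _ => ?_⟩, ?_⟩
    · ext e; simp [h]
    · rw [ncard_filter_edges K fun S hS S' hS' h => hinj hS hS' h]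
      exact h3 e
    · intro hP S hS S' hS' hne h
      refine hne (hinj hS hS' (h4 hP ?_ ?_ ?_))
      · exact Finset.mem_coe.2 (Finset.mem_image_of_mem _ hS)
      · exact Finset.mem_coe.2 (Finset.mem_image_of_mem _ hS')
      · rwa [hverts S (hK hS) S' (hK hS')]

end Problems

/-! ### The kernelization algorithm on adjacency matrices -/

section Algorithm

/-- The adjacency matrix of a graph. -/
noncomputable def adjMatrixList {n : ℕ} (G : SimpleGraph (Fin n)) : List (List Bool) :=
  open Classical in List.ofFn fun i => List.ofFn fun j => decide (G.Adj i j)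

/-- An entry of a matrix. -/
def entry (M : List (List Bool)) (u v : ℕ) : Bool := (M.getD u []).getD v false

/-- The edges of a graph, as a list of pairs. -/
noncomputable def edgeList {h : ℕ} (H : SimpleGraph (Fin h)) : List (Fin h × Fin h) :=
  (Set.toFinite H.edgeSet).toFinset.toList.map Quot.out

/-- The edge sets of the copies of members of `F` in the graph with the adjacency matrix `M`. -/
noncomputable def candidates (F : GraphFamily) (M : List (List Bool)) : List (List (Sym2 ℕ)) :=
  F.toList.flatMap fun H =>
    ((tuples (List.range M.length) H.1).filter fun m =>
      (edgeList H.2).all fun p => entry M (m.getD p.1 0) (m.getD p.2 0)).map fun m =>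
        (edgeList H.2).map fun p => s(m.getD p.1 0, m.getD p.2 0)

/-- The vertices below `n` that are end points of edges in the given sets. -/
def usedVertices (n : ℕ) (T : List (List (Sym2 ℕ))) : List ℕ :=
  (List.range n).filter fun v => T.any fun S => S.any fun e => decide (v ∈ e)

/-- The submatrix with the given rows and columns. -/
def submatrixList (M : List (List Bool)) (W : List ℕ) : List (List Bool) :=
  W.map fun u => W.map fun v => entry M u v

/-- The kernelization: restrict the graph to the vertices of the selected copies. -/
noncomputable def kernelize (F : GraphFamily) (r D : ℕ) (I : ℕ × List (List Bool)) :
    ℕ × List (List Bool) :=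
  (I.1, submatrixList I.2 (usedVertices I.2.length (select r D I.1 (candidates F I.2))))

theorem code_instance {n : ℕ} (G : SimpleGraph (Fin n)) (k : ℕ) :
    encodeInstance G k = code (k, adjMatrixList G) := by
  classical
  simp only [encodeInstance, encodeGraph, adjMatrixList, code_pair]
  congr 1
  simp only [code, List.map_ofFn, Function.comp_def]

theorem length_adjMatrixList {n : ℕ} (G : SimpleGraph (Fin n)) : (adjMatrixList G).length = n := by
  simp [adjMatrixList]

theorem entry_adjMatrixList {n : ℕ} (G : SimpleGraph (Fin n)) (u v : Fin n) :
    entry (adjMatrixList G) u v = true ↔ G.Adj u v := by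
  simp [entry, adjMatrixList]

theorem length_edgeList {h : ℕ} (H : SimpleGraph (Fin h)) :
    (edgeList H).length = H.edgeSet.ncard := by
  rw [edgeList, List.length_map, Finset.length_toList, Set.ncard_eq_toFinset_card]

theorem image_edgeList {h : ℕ} (H : SimpleGraph (Fin h)) :
    {e | ∃ p ∈ edgeList H, s(p.1, p.2) = e} = H.edgeSet := by
  have hout : ∀ e : Sym2 (Fin h), s((Quot.out e).1, (Quot.out e).2) = e := fun e => Quot.out_eq e
  ext e
  simp [edgeList, hout]

theorem forall_mem_edgeList {h : ℕ} (H : SimpleGraph (Fin h)) {p : Fin h × Fin h}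
    (hp : p ∈ edgeList H) : H.Adj p.1 p.2 := by
  rw [← SimpleGraph.mem_edgeSet, ← image_edgeList]
  exact ⟨p, hp, rfl⟩

theorem coe_toFinset_map_edgeList {h : ℕ} (H : SimpleGraph (Fin h)) (φ : Fin h → ℕ) :
    (((edgeList H).map fun p => s(φ p.1, φ p.2)).toFinset : Set (Sym2 ℕ)) =
      Sym2.map φ '' H.edgeSet := by
  rw [← image_edgeList]
  ext e
  simp

/-- A list of distinct vertices, one for each vertex of the family member, is the same as an
injective map. Its length ensures that the default of `getD` is never read. -/
theorem mem_candidates_iff {F : GraphFamily} {n : ℕ} {G : SimpleGraph (Fin n)}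
    {c : List (Sym2 ℕ)} : c ∈ candidates F (adjMatrixList G) ↔ ∃ H ∈ F, ∃ φ : Fin H.1 → Fin n,
      Function.Injective φ ∧ (∀ i j, H.2.Adj i j → G.Adj (φ i) (φ j)) ∧
        c = (edgeList H.2).map fun p => s((φ p.1 : ℕ), (φ p.2 : ℕ)) := by
  simp only [candidates, List.mem_flatMap, Finset.mem_toList, List.mem_map, List.mem_filter,
    mem_tuples, length_adjMatrixList, List.all_eq_true]
  refine exists_congr fun H => and_congr_right fun _ => ?_
  constructor
  · rintro ⟨m, ⟨⟨h1, h2, h3⟩, h4⟩, rfl⟩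
    have hlt : ∀ i : Fin H.1, (i : ℕ) < m.length := fun i => by
      rw [h1]; exact i.2
    have hget : ∀ i : Fin H.1, m.getD i 0 = m[(i : ℕ)]'(hlt i) := fun i => by
      rw [List.getD_eq_getElem _ _ (hlt i)]
    refine ⟨fun i => ⟨m[(i : ℕ)]'(hlt i), List.mem_range.1 (h3 (List.getElem_mem _))⟩, ?_, ?_, ?_⟩
    · intro i j h
      exact Fin.ext ((h2.getElem_inj_iff).1 (Fin.mk.inj h))
    · have key : ∀ p ∈ edgeList H.2, G.Adj
          ⟨m[(p.1 : ℕ)]'(hlt p.1), List.mem_range.1 (h3 (List.getElem_mem _))⟩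
          ⟨m[(p.2 : ℕ)]'(hlt p.2), List.mem_range.1 (h3 (List.getElem_mem _))⟩ := fun p hp => by
        have := h4 p hp
        rw [hget, hget] at this
        exact (entry_adjMatrixList G ⟨_, _⟩ ⟨_, _⟩).1 this
      intro i j hij
      have : s(i, j) ∈ H.2.edgeSet := hij
      rw [← image_edgeList] at this
      obtain ⟨⟨a, b⟩, hp, he⟩ := this
      -- `edgeList` lists each edge in one arbitrary orientation; symmetry of adjacency covers the
      -- other.
      rcases Sym2.eq_iff.1 he with ⟨rfl, rfl⟩ | ⟨rfl, rfl⟩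
      · exact key _ hp
      · exact (key _ hp).symm
    · refine List.map_congr_left fun p _ => ?_
      rw [hget, hget]
  · rintro ⟨φ, h1, h2, rfl⟩
    have hget : ∀ i : Fin H.1, (List.ofFn fun i => (φ i : ℕ)).getD i 0 = φ i := fun i => by simp
    refine ⟨List.ofFn fun i => (φ i : ℕ), ⟨⟨by simp, ?_, ?_⟩, fun p hp => ?_⟩, ?_⟩
    · exact List.nodup_ofFn.2 fun i j h => h1 (Fin.ext h)
    · intro v hv
      obtain ⟨i, rfl⟩ := List.mem_ofFn.1 hv
      simp
    · rw [hget, hget, entry_adjMatrixList]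
      exact h2 _ _ (forall_mem_edgeList _ hp)
    · refine List.map_congr_left fun p _ => ?_
      rw [hget, hget]

theorem card_le_of_mem_candidates {F : GraphFamily} {n : ℕ} {G : SimpleGraph (Fin n)}
    {c : List (Sym2 ℕ)} (hc : c ∈ candidates F (adjMatrixList G)) :
    c.toFinset.card ≤ maxEdges F := by
  obtain ⟨H, hH, φ, -, -, rfl⟩ := mem_candidates_iff.1 hc
  refine (List.toFinset_card_le _).trans ?_
  rw [List.length_map, length_edgeList]
  exact Finset.le_sup (f := fun H : Σ h : ℕ, SimpleGraph (Fin h) => H.2.edgeSet.ncard) hH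

theorem image_toFinset_candidates {F : GraphFamily} {n : ℕ} {G : SimpleGraph (Fin n)} :
    {A | ∃ c ∈ candidates F (adjMatrixList G), c.toFinset = A} =
      Finset.image (Sym2.map Fin.val) '' {A | IsCopyEdgeSet F G A} := by
  have hmap : ∀ {h : ℕ} (φ : Fin h → Fin n), (Sym2.map fun i => (φ i : ℕ)) =
      Sym2.map Fin.val ∘ Sym2.map φ := fun φ => by rw [← Sym2.map_comp]; rfl
  ext A
  constructor
  · rintro ⟨c, hc, rfl⟩
    obtain ⟨H, hH, φ, h1, h2, rfl⟩ := mem_candidates_iff.1 hc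
    refine ⟨(Set.toFinite (Sym2.map φ '' H.2.edgeSet)).toFinset,
      ⟨H, hH, φ, h1, h2, by simp⟩, ?_⟩
    rw [← Finset.coe_inj, coe_toFinset_map_edgeList H.2 fun i => (φ i : ℕ), Finset.coe_image,
      Set.Finite.coe_toFinset, hmap φ, Set.image_comp]
  · rintro ⟨A, ⟨H, hH, φ, h1, h2, h3⟩, rfl⟩
    refine ⟨_, mem_candidates_iff.2 ⟨H, hH, φ, h1, h2, rfl⟩, ?_⟩
    rw [← Finset.coe_inj, coe_toFinset_map_edgeList H.2 fun i => (φ i : ℕ), Finset.coe_image, h3,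
      hmap φ, Set.image_comp]

namespace PolyTime

variable {α : Type} [TreeCode α]

theorem entry {M : α → List (List Bool)} {u v : α → ℕ} (hM : PolyTime M) (hu : PolyTime u)
    (hv : PolyTime v) : PolyTime (fun a => _root_.entry (M a) (u a) (v a)) :=
  (hM.getD hu []).getD hv false

theorem candidates (F : GraphFamily) {M : α → List (List Bool)} (hM : PolyTime M) :
    PolyTime (fun a => _root_.candidates F (M a)) :=
  flatMap_const F.toList fun H => ((tuples (natEq fst snd) hM.length.range H.1).filter
    (all_const (edgeList H.2) (p := fun p (x : α × List ℕ) =>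
      _root_.entry (M x.1) (x.2.getD p.1 0) (x.2.getD p.2 0)) fun _ =>
        (hM.comp fst).entry (snd.getD (const _) 0) (snd.getD (const _) 0))).map
    (map_const (edgeList H.2) (f := fun p (x : α × List ℕ) =>
      s(x.2.getD p.1 0, x.2.getD p.2 0)) fun _ =>
        sym2Mk (snd.getD (const _) 0) (snd.getD (const _) 0))

theorem usedVertices {n : α → ℕ} {T : α → List (List (Sym2 ℕ))} (hn : PolyTime n)
    (hT : PolyTime T) : PolyTime (fun a => _root_.usedVertices (n a) (T a)) :=
  hn.range.filter ((hT.comp fst).any (p := fun (x : α × ℕ) S => S.any fun e => decide (x.2 ∈ e))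
    (snd.any (p := fun (x : (α × ℕ) × List (Sym2 ℕ)) e => decide (x.1.2 ∈ e))
      (sym2Mem (snd.comp (fst.comp fst)) snd)))

theorem submatrixList {M : α → List (List Bool)} {W : α → List ℕ} (hM : PolyTime M)
    (hW : PolyTime W) : PolyTime (fun a => _root_.submatrixList (M a) (W a)) :=
  hW.map ((hW.comp fst).map (f := fun x v => _root_.entry (M x.1) x.2 v)
    ((hM.comp (fst.comp fst)).entry (snd.comp fst) snd))

theorem kernelize (F : GraphFamily) (r D : ℕ) : PolyTime (_root_.kernelize F r D) :=
  fst.pair (submatrixList snd (usedVertices snd.length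
    (select (sym2Eq fst snd) r D fst (candidates F snd))))

end PolyTime

end Algorithm

/-- A polynomial-time transformation of encoded instances yields a kernel. -/
theorem hasKernelWithVertices_of_polyTime {Q : ParamGraphProblem} {b : ℕ → ℕ}
    {f : ℕ × List (List Bool) → ℕ × List (List Bool)} (hf : PolyTime f)
    (h : ∀ (n : ℕ) (G : SimpleGraph (Fin n)) (k : ℕ),
      ∃ (n' : ℕ) (G' : SimpleGraph (Fin n')) (k' : ℕ),
        f (k, adjMatrixList G) = (k', adjMatrixList G') ∧ (Q n G k ↔ Q n' G' k') ∧ k' ≤ k ∧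
          n' ≤ b k) : HasKernelWithVertices Q b := by
  obtain ⟨q, -, hq⟩ := hf
  -- Input and output are both held in variable `0`.
  obtain ⟨c, hc⟩ := hq 0
  refine ⟨c, q, fun n G k => ?_⟩
  obtain ⟨n', G', k', h1, h2, h3, h4⟩ := h n G k
  obtain ⟨T, s, e1, e2, e3, -⟩ := hc (inputStore (encodeInstance G k)) (k, adjMatrixList G)
    (by simp [inputStore, code_instance])
  refine ⟨n', G', k', ⟨T, s, e2.trans ?_, e1, ?_⟩, h2, h3, h4⟩
  · rw [code_instance, csize]
  · rw [e3, h1, code_instance]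

/-! ### Correctness and size of the kernel -/

section Correctness

variable {F : GraphFamily} {n : ℕ}

theorem submatrixList_eq (G : SimpleGraph (Fin n)) {W : List ℕ} (hW : ∀ v ∈ W, v < n) :
    submatrixList (adjMatrixList G) W =
      adjMatrixList (G.comap fun i : Fin W.length => (⟨W[i], hW _ (List.getElem_mem _)⟩ : Fin n)) := by
  classical
  have h : ∀ (β : Type) (g : ℕ → β), W.map g = List.ofFn fun i : Fin W.length => g W[i] :=
    fun β g => by
      refine List.ext_getElem (by simp) fun i h1 h2 => by simp
  rw [submatrixList, h, adjMatrixList]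
  congr 1
  funext i
  rw [h]
  congr 1
  funext j
  rw [Bool.eq_iff_iff, decide_eq_true_eq]
  exact entry_adjMatrixList G ⟨W[i], hW _ (List.getElem_mem _)⟩ ⟨W[j], hW _ (List.getElem_mem _)⟩

/-- Sub-collections of the copies in `G` that span only vertices in the range of an embedding are
collections of copies in the induced graph. -/
theorem isCopyEdgeSet_comap (hF : NoIsolatedVertices F) {m : ℕ} {G : SimpleGraph (Fin n)}
    {f : Fin m → Fin n} {A : Finset (Sym2 (Fin n))} (hA : IsCopyEdgeSet F G A)
    (hf : ∀ v ∈ endpoints A, v ∈ Set.range f) :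
    ∃ A', IsCopyEdgeSet F (G.comap f) A' ∧ A'.image (Sym2.map f) = A := by
  obtain ⟨H, hH, φ, h1, h2, h3⟩ := hA
  -- Every vertex of the copy is an end point of one of its edges, as there are no isolated
  -- vertices; hence the whole copy lies in the range of `f`.
  have hφ : ∀ i, ∃ i', f i' = φ i := fun i => by
    have := hF H hH i
    simp only [SimpleGraph.IsIsolated, not_forall, not_not] at this
    obtain ⟨j, hj⟩ := this
    refine hf _ (mem_endpoints.2 ⟨s(φ i, φ j), ?_, by simp⟩)
    rw [← Finset.mem_coe, h3]
    exact ⟨s(i, j), hj, rfl⟩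
  choose ψ hψ using hφ
  have hψ' : f ∘ ψ = φ := funext hψ
  refine ⟨(Set.toFinite (Sym2.map ψ '' H.2.edgeSet)).toFinset, ⟨H, hH, ψ, ?_, ?_, by simp⟩, ?_⟩
  · exact Function.Injective.of_comp (f := f) (by rwa [hψ'])
  · intro i j hij
    rw [SimpleGraph.comap_adj, hψ, hψ]
    exact h2 i j hij
  · rw [← Finset.coe_inj, Finset.coe_image, Set.Finite.coe_toFinset, h3, ← hψ', Sym2.map_comp,
      Set.image_comp]

theorem IsCopyEdgeSet.image_of_comap {m : ℕ} {G : SimpleGraph (Fin n)} {f : Fin m → Fin n}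
    (hf : Function.Injective f) {A : Finset (Sym2 (Fin m))} (hA : IsCopyEdgeSet F (G.comap f) A) :
    IsCopyEdgeSet F G (A.image (Sym2.map f)) := by
  obtain ⟨H, hH, φ, h1, h2, h3⟩ := hA
  refine ⟨H, hH, f ∘ φ, hf.comp h1, h2, ?_⟩
  rw [Finset.coe_image, h3, Sym2.map_comp, Set.image_comp]

theorem IsPackingOfSize.mono {α β : Type*} [DecidableEq α] {𝒮 𝒮' : Set (Finset α)} {P : Prop}
    {ν : Finset α → β} {t k : ℕ} {K : Finset (Finset α)} (hK : IsPackingOfSize 𝒮 P ν t k K)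
    (h : 𝒮 ⊆ 𝒮') : IsPackingOfSize 𝒮' P ν t k K :=
  ⟨hK.1, hK.2.1.trans h, hK.2.2⟩

theorem mem_usedVertices {T : List (List (Sym2 ℕ))} {v : ℕ} :
    v ∈ usedVertices n T ↔ v < n ∧ ∃ A ∈ setSystem T, v ∈ endpoints A := by
  simp [usedVertices, mem_setSystem, mem_endpoints]

theorem nodup_usedVertices (n : ℕ) (T : List (List (Sym2 ℕ))) : (usedVertices n T).Nodup :=
  List.nodup_range.filter _

/-- An empty set of edges contributes no vertices, so it is enough to count the kept sets that
properly contain `∅`. -/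
theorem length_usedVertices_le {r b : ℕ} {T : List (List (Sym2 ℕ))}
    (hr : ∀ A ∈ setSystem T, A.card ≤ r)
    (hb : ((setSystem T).filter (∅ ⊂ ·)).card ≤ b) :
    (usedVertices n T).length ≤ b * (2 * r) := by
  rw [← List.toFinset_card_of_nodup (nodup_usedVertices n T)]
  refine (Finset.card_le_card (t := ((setSystem T).filter (∅ ⊂ ·)).biUnion endpoints) ?_).trans
    ((Finset.card_biUnion_le_card_mul _ _ (2 * r) fun A hA => ?_).trans
      (Nat.mul_le_mul_right _ hb))
  · intro v hv
    obtain ⟨-, A, hA, hv⟩ := mem_usedVertices.1 (List.mem_toFinset.1 hv)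
    refine Finset.mem_biUnion.2 ⟨A, Finset.mem_filter.2 ⟨hA, ?_⟩, hv⟩
    obtain ⟨e, he, -⟩ := mem_endpoints.1 hv
    exact Finset.empty_ssubset.2 ⟨e, he⟩
  · have := card_endpoints_le A
    have := hr A (Finset.mem_filter.1 hA).1
    omega

/-- Exchange moves a solution of `G` into the kept copies, all of which survive in the induced
graph. Conversely, copies in the induced graph are copies in `G`, whether kept or not. -/
theorem packingProblem_comap_iff (hF : NoIsolatedVertices F) {t k r g : ℕ} {P : Prop} (ht : 1 ≤ t)
    (hr : r = maxEdges F) (hg : g = 2 ^ (2 * r + 1).choose 2) (G : SimpleGraph (Fin n))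
    {W : List ℕ} (hW : W = usedVertices n (select r (r + g) k (candidates F (adjMatrixList G))))
    (hWn : ∀ v ∈ W, v < n) :
    PackingProblem F t P n G k ↔ PackingProblem F t P W.length
      (G.comap fun i : Fin W.length => (⟨W[i], hWn _ (List.getElem_mem _)⟩ : Fin n)) k := by
  set f : Fin W.length → Fin n := fun i => ⟨W[i], hWn _ (List.getElem_mem _)⟩ with hf
  have hfinj : Function.Injective f := fun i j h =>
    Fin.ext (((hW ▸ nodup_usedVertices n _ : W.Nodup).getElem_inj_iff).1 (Fin.mk.inj h))
  rw [packingProblem_iff hF, packingProblem_iff hF, ← exists_isPackingOfSize_image_iff hfinj]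
  constructor
  · rw [← exists_isPackingOfSize_image_iff Fin.val_injective, ← image_toFinset_candidates,
      ← exists_isPackingOfSize_image_iff Fin.val_injective]
    rintro ⟨K, hK⟩
    have hcs : ∀ S ∈ candidates F (adjMatrixList G), S.toFinset.card ≤ r := fun S hS =>
      hr ▸ card_le_of_mem_candidates hS
    set T := select r (r + g) k (candidates F (adjMatrixList G)) with hT
    have hTsub : ∀ A ∈ setSystem T, A ∈
        {A | ∃ c ∈ candidates F (adjMatrixList G), c.toFinset = A} := fun A hA => by
      obtain ⟨c, hc, rfl⟩ := mem_setSystem.1 hA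
      exact ⟨c, select_subset _ _ _ _ hc, rfl⟩
    have hcard : ∀ S ∈ {A | ∃ c ∈ candidates F (adjMatrixList G), c.toFinset = A}, S.card ≤ r := by
      rintro _ ⟨c, hc, rfl⟩
      exact hcs c hc
    obtain ⟨K', hK'⟩ := hK.exists_of_selection (g := g) (hg ▸ Nat.one_le_two_pow) ht
      -- With this `B` the recursion for `threshold` is exactly the growth condition of the
      -- exchange.
      (B := fun j => threshold (r + g) k (r - j)) (𝒯 := setSystem T) hcard hTsub
      (fun b => hg ▸ card_filter_endpoints_le (fun A hA => hcard A (hTsub A hA)) b)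
      (fun j hj => by
        simp only [show r - j = r - (j + 1) + 1 by omega, threshold]; exact le_rfl)
      (fun Y _ => card_filter_select_le hcs Y)
      (by rintro _ ⟨c, hc, rfl⟩; exact mem_or_exists_of_mem hcs hc)
    refine ⟨K', hK'.mono fun A hA => ?_⟩
    have hA' := hTsub A (Finset.mem_coe.1 hA)
    rw [image_toFinset_candidates] at hA'
    obtain ⟨A', hA', rfl⟩ := hA'
    refine ⟨A', isCopyEdgeSet_comap hF hA' fun v hv => ?_, rfl⟩
    have : (v : ℕ) ∈ W := by
      rw [hW, mem_usedVertices]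
      refine ⟨v.2, _, Finset.mem_coe.1 hA, ?_⟩
      rw [endpoints_image]
      exact Finset.mem_image_of_mem _ hv
    obtain ⟨i, hi, h⟩ := List.getElem_of_mem this
    exact ⟨⟨i, hi⟩, Fin.ext h⟩
  · rintro ⟨K, hK⟩
    refine ⟨K, hK.mono ?_⟩
    rintro _ ⟨A, hA, rfl⟩
    exact IsCopyEdgeSet.image_of_comap hfinj hA

/-- The constant in the size of the kernel. -/
def kernelConstant (r : ℕ) : ℕ := 2 * r * r * (r + 2 ^ (2 * r + 1).choose 2) ^ r

theorem packingProblem_hasKernel (hF : NoIsolatedVertices F) {t : ℕ} (ht : 1 ≤ t) (P : Prop) :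
    HasKernelWithVertices (PackingProblem F t P) fun k =>
      kernelConstant (maxEdges F) * ((maxEdges F + 1) ^ maxEdges F * k ^ maxEdges F) := by
  set r := maxEdges F with hr
  set g := 2 ^ (2 * r + 1).choose 2 with hg
  refine hasKernelWithVertices_of_polyTime (PolyTime.kernelize F r (r + g)) fun n G k => ?_
  set T := select r (r + g) k (candidates F (adjMatrixList G)) with hT
  have hcs : ∀ S ∈ candidates F (adjMatrixList G), S.toFinset.card ≤ r := fun S hS =>
    hr ▸ card_le_of_mem_candidates hS
  have hWn : ∀ v ∈ usedVertices n T, v < n := fun v hv => (mem_usedVertices.1 hv).1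
  refine ⟨_, _, k, ?_, packingProblem_comap_iff hF ht hr hg G rfl hWn, le_rfl, ?_⟩
  · rw [kernelize, length_adjMatrixList]
    exact congrArg (Prod.mk k) (submatrixList_eq G hWn)
  · refine (length_usedVertices_le (r := r) (fun A hA => ?_)
      (card_filter_select_le hcs ∅)).trans ?_
    · obtain ⟨c, hc, rfl⟩ := mem_setSystem.1 hA
      exact hcs c (select_subset _ _ _ _ hc)
    · rw [Finset.card_empty, Nat.sub_zero]
      calc threshold (r + g) k r * (2 * r) ≤ r * ((r + g) * k) ^ r * (2 * r) :=
            Nat.mul_le_mul_right _ (threshold_le _ _ _)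
        _ = kernelConstant r * (1 * k ^ r) := by
            rw [kernelConstant, ← hg, mul_pow]; ring
        -- The factor `(r + 1) ^ r` is pure slack, since the constant may depend on `r`.
        _ ≤ kernelConstant r * ((r + 1) ^ r * k ^ r) := by
            gcongr
            exact Nat.one_le_pow _ _ (Nat.succ_pos r)

end Correctness

theorem mainTheorem7 :
    ∃ C : ℕ → ℕ, ∀ (F : GraphFamily) (t : ℕ), NoIsolatedVertices F → 1 ≤ t →
      HasKernelWithVertices (EdgeMembershipProblem F t)
        (fun k => C (maxEdges F) * ((maxEdges F + 1) ^ maxEdges F * k ^ maxEdges F)) ∧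
      HasKernelWithVertices (EdgeMembershipProblemNISV F t)
        (fun k => C (maxEdges F) * ((maxEdges F + 1) ^ maxEdges F * k ^ maxEdges F)) := by
  refine ⟨kernelConstant, fun F t hF ht => ⟨?_, ?_⟩⟩
  · have h : EdgeMembershipProblem F t = PackingProblem F t False := by
      funext n G k
      simp [EdgeMembershipProblem, PackingProblem]
    rw [h]
    exact packingProblem_hasKernel hF ht False
  · have h : EdgeMembershipProblemNISV F t = PackingProblem F t True := by
      funext n G k
      simp [EdgeMembershipProblemNISV, PackingProblem]
    rw [h]
    exact packingProblem_hasKernel hF ht True
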